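/- Let $L,\nu,\alpha,\mu,h>0$ and $c\in\mathbb R$, and for $\varphi\in H^1(0,L)$ put $\|\varphi\|_{H^1}^2=\frac1{L^2}\|\varphi\|_{L^2}^2+\|\varphi_x\|_{L^2}^2$. Let $I_h:H^1(0,L)\to L^2(0,L)$ be a linear map with $\|\varphi-I_h\varphi\|_{L^2}\le c\,h\,\|\varphi\|_{H^1}$ for all $\varphi\in H^1(0,L)$. Assume that $r:=\mu-\left(2\alpha+\frac{\nu}{L^2}\right)>0$ and $\nu\ge\mu c^2h^2$. Then for every $u_0\in H^1(0,L)$ the feedback Chafee–Infante system $$u_t-\nu u_{xx}-\alpha u+u^3=-\mu I_h(u),\qquad u_x(t,0)=u_x(t,L)=0,\qquad u(0)=u_0,$$ has a unique global solution $u:[0,\infty)\to H^1(0,L)$, where a global solution is a function with $u\in C([0,T];H^1)\cap L^2([0,T];H^2)$ and $u_t\in L^2([0,T];L^2)$ for every $T>0$, which satisfies the equation in $L^2(0,L)$ and the boundary conditions for almost every $t>0$. Moreover, this solution satisfies $$\|u(t)\|_{L^2}^2\le e^{-rt}\|u_0\|_{L^2}^2\qquad\text{for all }t\ge 0.$$ 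-/

import Mathlib

open MeasureTheory Set Filter
open scoped Topology ContDiff

noncomputable section

namespace ChafeeInfante

/-- The real Lebesgue space `L²(0, L)`. -/
abbrev L2 (L : ℝ) : Type := Lp ℝ 2 (volume.restrict (Ioo (0 : ℝ) L))

/-- `g` is the weak derivative of `f` on `(0, L)`. -/
def IsWeakDeriv (L : ℝ) (f g : L2 L) : Prop :=
  ∀ ψ : ℝ → ℝ, ContDiff ℝ ∞ ψ → HasCompactSupport ψ → tsupport ψ ⊆ Ioo 0 L →
    ∫ x in Ioo 0 L, f x * deriv ψ x = -∫ x in Ioo 0 L, g x * ψ x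

theorem integrable_mul_test {L : ℝ} (f : L2 L) {ψ : ℝ → ℝ} (hψ : Continuous ψ)
    (hc : HasCompactSupport ψ) :
    Integrable (fun x => f x * ψ x) (volume.restrict (Ioo (0 : ℝ) L)) := by
  obtain ⟨C, hC⟩ := hc.exists_bound_of_continuous hψ
  have hf : Integrable (fun x => f x) (volume.restrict (Ioo (0 : ℝ) L)) :=
    (Lp.memLp f).integrable (by norm_num)
  exact hf.mul_bdd hψ.aestronglyMeasurable (ae_of_all _ hC)

theorem IsWeakDeriv.zero (L : ℝ) : IsWeakDeriv L 0 0 := by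
  intro ψ _ _ _
  have h0 := Lp.coeFn_zero ℝ 2 (volume.restrict (Ioo (0 : ℝ) L))
  have h1 : ∀ φ : ℝ → ℝ, ∫ x in Ioo 0 L, (0 : L2 L) x * φ x = 0 := fun φ =>
    integral_eq_zero_of_ae (by filter_upwards [h0] with x hx; rw [hx]; simp)
  rw [h1, h1, neg_zero]

theorem IsWeakDeriv.add {L : ℝ} {f₁ f₂ g₁ g₂ : L2 L} (h₁ : IsWeakDeriv L f₁ g₁)
    (h₂ : IsWeakDeriv L f₂ g₂) : IsWeakDeriv L (f₁ + f₂) (g₁ + g₂) := by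
  have key : ∀ (a b : L2 L) (φ : ℝ → ℝ), Continuous φ → HasCompactSupport φ →
      ∫ x in Ioo 0 L, (a + b) x * φ x
        = (∫ x in Ioo 0 L, a x * φ x) + ∫ x in Ioo 0 L, b x * φ x := by
    intro a b φ hφ hc
    rw [← integral_add (integrable_mul_test a hφ hc) (integrable_mul_test b hφ hc)]
    refine integral_congr_ae ?_
    filter_upwards [Lp.coeFn_add a b] with x hx
    rw [hx, Pi.add_apply, add_mul]
  intro ψ hψ hc hs
  rw [key f₁ f₂ _ (hψ.continuous_deriv (by simp)) hc.deriv, key g₁ g₂ _ hψ.continuous hc,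
    h₁ ψ hψ hc hs, h₂ ψ hψ hc hs]
  ring

theorem IsWeakDeriv.smul {L : ℝ} {f g : L2 L} (a : ℝ) (h : IsWeakDeriv L f g) :
    IsWeakDeriv L (a • f) (a • g) := by
  have key : ∀ (b : L2 L) (φ : ℝ → ℝ),
      ∫ x in Ioo 0 L, (a • b) x * φ x = a * ∫ x in Ioo 0 L, b x * φ x := by
    intro b φ
    rw [← integral_const_mul]
    refine integral_congr_ae ?_
    filter_upwards [Lp.coeFn_smul a b] with x hx
    simp [hx, mul_assoc]
  intro ψ hψ hc hs
  rw [key, key, h ψ hψ hc hs]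
  ring

/-- The Sobolev space `H¹(0, L)`, as a subspace of `L²(0, L)`. The norm used on it is `h1Norm`
below, never the one inherited from `L²`. -/
def H1 (L : ℝ) : Submodule ℝ (L2 L) where
  carrier := {f | ∃ g, IsWeakDeriv L f g}
  zero_mem' := ⟨0, IsWeakDeriv.zero L⟩
  add_mem' := fun ⟨_, h₁⟩ ⟨_, h₂⟩ => ⟨_, h₁.add h₂⟩
  smul_mem' := fun a _ ⟨_, h⟩ => ⟨_, h.smul a⟩

/-- Weak derivatives are unique in `L²(0, L)`. -/
theorem IsWeakDeriv.unique {L : ℝ} {f g₁ g₂ : L2 L} (h₁ : IsWeakDeriv L f g₁)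
    (h₂ : IsWeakDeriv L f g₂) : g₁ = g₂ := by
  have h : IsWeakDeriv L 0 (g₁ - g₂) := by
    have := h₁.add (h₂.smul (-1))
    simpa [sub_eq_add_neg] using this
  have hint : Integrable (fun x => (g₁ - g₂) x) (volume.restrict (Ioo (0 : ℝ) L)) :=
    (Lp.memLp (g₁ - g₂)).integrable (by norm_num)
  have hz : ∀ᵐ x ∂(volume : Measure ℝ), x ∈ Ioo (0 : ℝ) L → (g₁ - g₂) x = 0 := by
    refine isOpen_Ioo.ae_eq_zero_of_integral_contDiff_smul_eq_zero
      (IntegrableOn.locallyIntegrableOn hint) ?_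
    intro ψ hψ hc hs
    have e := h ψ hψ hc hs
    have h0 : ∫ x in Ioo 0 L, (0 : L2 L) x * deriv ψ x = 0 :=
      integral_eq_zero_of_ae (by
        filter_upwards [Lp.coeFn_zero ℝ 2 (volume.restrict (Ioo (0 : ℝ) L))] with x hx
        rw [hx]; simp)
    rw [h0, zero_eq_neg] at e
    refine Eq.trans ?_ e
    rw [← integral_indicator measurableSet_Ioo]
    refine integral_congr_ae (ae_of_all _ fun x => ?_)
    by_cases hx : x ∈ Ioo 0 L
    · simp [hx, mul_comm]
    · have : ψ x = 0 := image_eq_zero_of_notMem_tsupport fun h' => hx (hs h')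
      rw [indicator_of_notMem hx]
      exact (congrArg (fun a => a • (g₁ - g₂) x) this).trans (zero_smul ℝ _)
  rw [← sub_eq_zero]
  refine Lp.ext ?_
  filter_upwards [(ae_restrict_iff' measurableSet_Ioo).2 hz,
    Lp.coeFn_zero ℝ 2 (volume.restrict (Ioo (0 : ℝ) L))] with x hx hx0
  rw [hx, hx0]
  rfl

/-- The weak derivative `φ_x ∈ L²(0, L)` of `φ ∈ H¹(0, L)`. -/
def weakDeriv {L : ℝ} (φ : H1 L) : L2 L := Classical.choose φ.2

theorem weakDeriv_spec {L : ℝ} (φ : H1 L) : IsWeakDeriv L φ (weakDeriv φ) :=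
  Classical.choose_spec φ.2

/-- `‖φ‖_{H¹}² = L⁻² ‖φ‖_{L²}² + ‖φ_x‖_{L²}²`. -/
def h1Norm {L : ℝ} (φ : H1 L) : ℝ :=
  Real.sqrt (1 / L ^ 2 * ‖(φ : L2 L)‖ ^ 2 + ‖weakDeriv φ‖ ^ 2)

/-- The continuous representative of `g` on `[0, L]` exists and vanishes at both end points. -/
def VanishesAtEndpoints (L : ℝ) (g : L2 L) : Prop :=
  ∃ G : ℝ → ℝ, ContinuousOn G (Icc 0 L) ∧ g =ᵐ[volume.restrict (Ioo 0 L)] G ∧ G 0 = 0 ∧ G L = 0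

/-- `u` is a global solution on `[0, ∞)` of
`u_t - ν u_xx - α u + u³ = -μ I(u)`, `u_x(0) = u_x(L) = 0`, `u(0) = u₀`,
in the class `C([0, T]; H¹) ∩ L²([0, T]; H²)`, `u_t ∈ L²([0, T]; L²)`, for all `T > 0`.
The values `u t` for `t < 0` are irrelevant. -/
structure IsGlobalSolution (L ν α μ : ℝ) (I : H1 L →ₗ[ℝ] L2 L) (u₀ : H1 L) (u : ℝ → H1 L) :
    Prop where
  initial : u 0 = u₀
  /-- continuity from `[0, ∞)` to `H¹` -/
  continuous_h1 : ∀ t, 0 ≤ t → Tendsto (fun s => h1Norm (u s - u t)) (𝓝[Ici 0] t) (𝓝 0)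
  /-- `ut` is the time derivative of `u` (so `u` is absolutely continuous into `L²`), `uxx` is
  the second spatial weak derivative, and the equation and the boundary conditions hold for
  almost every time. -/
  equation : ∃ ut uxx : ℝ → L2 L,
    (∀ T, 0 < T → MemLp ut 2 (volume.restrict (Ioo 0 T))) ∧
    (∀ T, 0 < T → MemLp uxx 2 (volume.restrict (Ioo 0 T))) ∧
    (∀ t, 0 ≤ t → (u t : L2 L) = (u 0 : L2 L) + ∫ s in (0 : ℝ)..t, ut s) ∧
    ∀ᵐ t ∂(volume.restrict (Ioi (0 : ℝ))),
      IsWeakDeriv L (weakDeriv (u t)) (uxx t) ∧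
      VanishesAtEndpoints L (weakDeriv (u t)) ∧
      ∀ᵐ x ∂(volume.restrict (Ioo 0 L)),
        ut t x - ν * uxx t x - α * (u t : L2 L) x + (u t : L2 L) x ^ 3 = -μ * I (u t) x

end ChafeeInfante

end

/-! Decay and uniqueness come from a single `L²` estimate. The difference `d` of two solutions
satisfies `d_t = ν d_xx + α d - (u³ - v³) - μ I(d)`. Tested with `d`, the cubic has a good sign by
monotonicity. Writing `⟨d, I d⟩ = ‖d‖² - ⟨d, d - I d⟩` and splitting the last product by Young's
inequality costs `μ/2 ‖d‖²` plus at most `ν/2` times the squared `H¹` norm of `d`, because `μ c² h²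
≤ ν`. What remains is `-(r/2) ‖d‖² - (ν/2) ‖d_x‖²` (`dissipation`), whence the factor `e^{-rt}`
(`IsGlobalSolution.norm_sub_sq_le`). Equal data give uniqueness; comparison with the zero solution
gives decay.

Existence is obtained in the Neumann cosine basis. Put `λ_k = 1 + ν (kπ/L)²`. The function `u` with
cosine coefficients `w_k / √λ_k` satisfies `‖w‖² = ‖u‖² + ν ‖u_x‖²`, so `ℓ²` parametrises `H¹`
(`toH1`), and the equation becomes `w_k' = -λ_k w_k + √λ_k F_k(w)` with `F` a map from `H¹` to `L²`.
The factor `√λ_k` is exactly what the parabolic inequality `‖w(t)‖² + ∫ Σ λ_k w_k² ≤ ‖w₀‖² + ∫ ‖f‖²`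
absorbs. For Lipschitz `F` a contraction in an exponentially weighted norm therefore gives a global
solution (`exists_mild_solution`), and the same inequality puts `u` in `L²(0, T; H²)`.

The cubic is not globally Lipschitz and is first replaced by a monotone truncation `g` at level `R`.
For the truncated system `K ‖u‖² + ‖w‖²` does not grow, with `K` independent of `R`
(`inner_energy_nonpos`): testing with `u` uses `dissipation`, and testing with `-ν u_xx` uses
`⟨g(u), u_xx⟩ ≤ 0`. Since the sup norm of `u` is controlled by `‖w‖` (`ae_abs_toH1_le`), `R` can be
fixed in advance so that the truncation never acts. -/

noncomputable section

namespace ChafeeInfante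

/-! ### Square-summable sequences -/

/-- The real Hilbert space of square-summable sequences. -/
abbrev SqSum : Type := lp (fun _ : ℕ => ℝ) 2

theorem SqSum.hasSum_sq (f : SqSum) : HasSum (fun k => f k ^ 2) (‖f‖ ^ 2) := by
  have h := lp.hasSum_inner (𝕜 := ℝ) f f
  rw [real_inner_self_eq_norm_sq] at h
  simpa [real_inner_self_eq_norm_sq] using h

theorem SqSum.sum_sq_le (f : SqSum) (s : Finset ℕ) : ∑ k ∈ s, f k ^ 2 ≤ ‖f‖ ^ 2 :=
  sum_le_hasSum s (fun _ _ => sq_nonneg _) f.hasSum_sq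

theorem SqSum.continuous_apply (k : ℕ) : Continuous fun f : SqSum => f k :=
  (lp.evalCLM ℝ (fun _ : ℕ => ℝ) 2 k).continuous

theorem memℓp_two_iff {a : ℕ → ℝ} :
    Memℓp (E := fun _ => ℝ) a 2 ↔ Summable fun k => a k ^ 2 := by
  rw [memℓp_gen_iff (by norm_num)]
  simp

theorem memℓp_two_of_sum_le {a : ℕ → ℝ} {C : ℝ}
    (h : ∀ N, ∑ k ∈ Finset.range N, a k ^ 2 ≤ C) : Memℓp (E := fun _ => ℝ) a 2 :=
  memℓp_two_iff.2 (summable_of_sum_range_le (fun _ => sq_nonneg _) h)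

theorem SqSum.norm_sq_le_of_sum_le {f : SqSum} {C : ℝ}
    (h : ∀ N, ∑ k ∈ Finset.range N, f k ^ 2 ≤ C) : ‖f‖ ^ 2 ≤ C := by
  rw [← f.hasSum_sq.tsum_eq]
  exact Real.tsum_le_of_sum_range_le (fun _ => sq_nonneg _) h

open Classical in
/-- The sequence `a` as an element of `ℓ²`, with the value `0` if it is not square-summable. -/
def toSqSum (a : ℕ → ℝ) : SqSum :=
  if h : Memℓp (E := fun _ => ℝ) a 2 then ⟨a, h⟩ else 0

theorem toSqSum_apply {a : ℕ → ℝ} (h : Memℓp (E := fun _ => ℝ) a 2) (k : ℕ) :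
    toSqSum a k = a k := by
  rw [toSqSum, dif_pos h]

/-- Truncation of a sequence to its first `N` entries. -/
def SqSum.trunc (N : ℕ) : SqSum →L[ℝ] SqSum :=
  ∑ k ∈ Finset.range N, (lp.singleContinuousLinearMap ℝ (fun _ : ℕ => ℝ) 2 k).comp
    (lp.evalCLM ℝ (fun _ : ℕ => ℝ) 2 k)

theorem SqSum.trunc_eq_sum (N : ℕ) (f : SqSum) :
    SqSum.trunc N f = ∑ k ∈ Finset.range N, lp.single 2 k (f k) := by
  simp [SqSum.trunc]
  rfl

theorem SqSum.trunc_apply (N : ℕ) (f : SqSum) (k : ℕ) :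
    SqSum.trunc N f k = if k < N then f k else 0 := by
  have : SqSum.trunc N f k = ∑ j ∈ Finset.range N, (lp.single 2 j (f j) : SqSum) k := by
    rw [SqSum.trunc_eq_sum]
    exact map_sum (lp.evalCLM ℝ (fun _ : ℕ => ℝ) 2 k) _ _
  rw [this]
  simp [lp.single_apply, Pi.single_apply]

theorem SqSum.tendsto_trunc (f : SqSum) : Tendsto (fun N => SqSum.trunc N f) atTop (𝓝 f) := by
  simp_rw [SqSum.trunc_eq_sum]
  exact (lp.hasSum_single (by norm_num) f).tendsto_sum_nat

theorem SqSum.norm_trunc_le (N : ℕ) (f : SqSum) : ‖SqSum.trunc N f‖ ≤ ‖f‖ := by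
  refine le_of_sq_le_sq ?_ (norm_nonneg _)
  refine SqSum.norm_sq_le_of_sum_le fun M => le_trans (Finset.sum_le_sum fun k _ => ?_)
    (f.sum_sq_le (Finset.range M))
  rw [SqSum.trunc_apply]
  split_ifs
  · exact le_rfl
  · simpa using sq_nonneg (f k)

theorem SqSum.norm_sub_trunc_le (N : ℕ) (f : SqSum) : ‖f - SqSum.trunc N f‖ ≤ ‖f‖ := by
  refine le_of_sq_le_sq ?_ (norm_nonneg _)
  refine SqSum.norm_sq_le_of_sum_le fun M => le_trans (Finset.sum_le_sum fun k _ => ?_)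
    (f.sum_sq_le (Finset.range M))
  rw [lp.coeFn_sub, Pi.sub_apply, SqSum.trunc_apply]
  split_ifs
  · simpa using sq_nonneg (f k)
  · simp

/-! ### The scalar linear equation -/

/-- The solution of `y' = -l y + √l φ`, `y 0 = y₀`. -/
def scalarDuhamel (l y₀ : ℝ) (φ : ℝ → ℝ) (t : ℝ) : ℝ :=
  Real.exp (-l * t) * (y₀ + √l * ∫ s in (0 : ℝ)..t, Real.exp (l * s) * φ s)

theorem scalarDuhamel_zero (l y₀ : ℝ) (φ : ℝ → ℝ) : scalarDuhamel l y₀ φ 0 = y₀ := by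
  simp [scalarDuhamel]

theorem scalarDuhamel_sub (l y₀ y₁ : ℝ) {φ ψ : ℝ → ℝ} (hφ : Continuous φ) (hψ : Continuous ψ)
    (t : ℝ) : scalarDuhamel l y₀ φ t - scalarDuhamel l y₁ ψ t
      = scalarDuhamel l (y₀ - y₁) (fun s => φ s - ψ s) t := by
  have : ∫ s in (0 : ℝ)..t, Real.exp (l * s) * (φ s - ψ s)
      = (∫ s in (0 : ℝ)..t, Real.exp (l * s) * φ s) -
        ∫ s in (0 : ℝ)..t, Real.exp (l * s) * ψ s := by
    rw [← intervalIntegral.integral_sub (Continuous.intervalIntegrable (by fun_prop) _ _)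
      (Continuous.intervalIntegrable (by fun_prop) _ _)]
    simp_rw [mul_sub]
  rw [scalarDuhamel, scalarDuhamel, scalarDuhamel, this]
  ring

theorem hasDerivAt_scalarDuhamel (l y₀ : ℝ) {φ : ℝ → ℝ} (hφ : Continuous φ) (t : ℝ) :
    HasDerivAt (scalarDuhamel l y₀ φ) (-l * scalarDuhamel l y₀ φ t + √l * φ t) t := by
  have hc : Continuous fun s => Real.exp (l * s) * φ s := by fun_prop
  have h1 : HasDerivAt (fun t => ∫ s in (0 : ℝ)..t, Real.exp (l * s) * φ s)
      (Real.exp (l * t) * φ t) t :=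
    intervalIntegral.integral_hasDerivAt_right (hc.intervalIntegrable _ _)
      (hc.stronglyMeasurableAtFilter _ _) hc.continuousAt
  have h2 : HasDerivAt (fun t => Real.exp (-l * t)) (Real.exp (-l * t) * (-l)) t := by
    simpa using ((hasDerivAt_id t).const_mul (-l)).exp
  refine (h2.mul ((h1.const_mul (√l)).const_add y₀)).congr_deriv ?_
  have h3 : Real.exp (-l * t) * Real.exp (l * t) = 1 := by
    rw [← Real.exp_add]; simp
  simp only [scalarDuhamel]
  linear_combination √l * φ t * h3

theorem continuous_scalarDuhamel (l y₀ : ℝ) {φ : ℝ → ℝ} (hφ : Continuous φ) :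
    Continuous (scalarDuhamel l y₀ φ) :=
  continuous_iff_continuousAt.2 fun t => (hasDerivAt_scalarDuhamel l y₀ hφ t).continuousAt

theorem hasDerivAt_integral_of_continuous {φ : ℝ → ℝ} (hφ : Continuous φ) (t : ℝ) :
    HasDerivAt (fun t => ∫ s in (0 : ℝ)..t, φ s) (φ t) t :=
  intervalIntegral.integral_hasDerivAt_right (hφ.intervalIntegrable _ _)
    (hφ.stronglyMeasurableAtFilter _ _) hφ.continuousAt

/-- Up to a constant, the right side minus the left side has derivative `(φ - √l y)²`. No constant
depends on `l`, so the estimate can be summed over all modes. -/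
theorem scalarDuhamel_energy {l : ℝ} (hl : 0 ≤ l) (y₀ : ℝ) {φ : ℝ → ℝ} (hφ : Continuous φ)
    {t : ℝ} (ht : 0 ≤ t) :
    scalarDuhamel l y₀ φ t ^ 2 + ∫ s in (0 : ℝ)..t, l * scalarDuhamel l y₀ φ s ^ 2
      ≤ y₀ ^ 2 + ∫ s in (0 : ℝ)..t, φ s ^ 2 := by
  set y := scalarDuhamel l y₀ φ with hy
  have hyc : Continuous y := continuous_scalarDuhamel l y₀ hφ
  let E : ℝ → ℝ := fun t => (∫ s in (0 : ℝ)..t, φ s ^ 2) - y t ^ 2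
    - ∫ s in (0 : ℝ)..t, l * y s ^ 2
  have hE : ∀ t, HasDerivAt E ((φ t - √l * y t) ^ 2) t := fun t => by
    have h1 := hasDerivAt_integral_of_continuous (hφ.pow 2) t
    have h2 := hasDerivAt_integral_of_continuous (φ := fun s => l * y s ^ 2) (by fun_prop) t
    have h3 := (hasDerivAt_scalarDuhamel l y₀ hφ t).pow 2
    refine ((h1.sub h3).sub h2).congr_deriv ?_
    have := Real.sq_sqrt hl
    simp only [← hy]
    push_cast
    simp only [Pi.pow_apply, pow_one]
    linear_combination - y t ^ 2 * this
  have hm : Monotone E := monotone_of_deriv_nonneg (fun t => (hE t).differentiableAt)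
    fun t => by rw [(hE t).deriv]; positivity
  have h0 := hm ht
  simp only [E, hy, scalarDuhamel_zero, intervalIntegral.integral_same] at h0
  simp only [← hy] at h0
  linarith

/-! ### The diagonal linear equation in `ℓ²` -/

/-- The mild solution of `w_k' = -λ_k w_k + √λ_k f_k`, `w 0 = w₀`. -/
def duhamel (lam : ℕ → ℝ) (w₀ : SqSum) (f : ℝ → SqSum) (t : ℝ) : SqSum :=
  toSqSum fun k => scalarDuhamel (lam k) (w₀ k) (fun s => f s k) t

theorem continuous_coord {f : ℝ → SqSum} (hf : Continuous f) (k : ℕ) :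
    Continuous fun s => f s k := (SqSum.continuous_apply k).comp hf

theorem sum_scalarDuhamel_energy {lam : ℕ → ℝ} (hlam : ∀ k, 0 ≤ lam k) (w₀ : SqSum)
    {f : ℝ → SqSum} (hf : Continuous f) {t : ℝ} (ht : 0 ≤ t) (s : Finset ℕ) :
    ∑ k ∈ s, (scalarDuhamel (lam k) (w₀ k) (fun s => f s k) t ^ 2 +
      ∫ r in (0 : ℝ)..t, lam k * scalarDuhamel (lam k) (w₀ k) (fun s => f s k) r ^ 2)
      ≤ ‖w₀‖ ^ 2 + ∫ r in (0 : ℝ)..t, ‖f r‖ ^ 2 := by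
  refine (Finset.sum_le_sum fun k _ =>
    scalarDuhamel_energy (hlam k) (w₀ k) (continuous_coord hf k) ht).trans ?_
  have hi : ∀ k ∈ s, IntervalIntegrable (fun r => f r k ^ 2) volume 0 t := fun k _ =>
    ((continuous_coord hf k).pow 2).intervalIntegrable _ _
  rw [Finset.sum_add_distrib, ← intervalIntegral.integral_finsetSum hi]
  refine add_le_add (w₀.sum_sq_le s) (intervalIntegral.integral_mono_on ht ?_ ?_ fun r _ =>
    (f r).sum_sq_le s)
  · exact (continuous_finsetSum _ fun k _ => (continuous_coord hf k).pow 2).intervalIntegrable _ _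
  · exact (hf.norm.pow 2).intervalIntegrable _ _

theorem sum_scalarDuhamel_sq_le {lam : ℕ → ℝ} (hlam : ∀ k, 0 ≤ lam k) (w₀ : SqSum)
    {f : ℝ → SqSum} (hf : Continuous f) {t : ℝ} (ht : 0 ≤ t) (s : Finset ℕ) :
    ∑ k ∈ s, scalarDuhamel (lam k) (w₀ k) (fun s => f s k) t ^ 2
      ≤ ‖w₀‖ ^ 2 + ∫ r in (0 : ℝ)..t, ‖f r‖ ^ 2 := by
  refine le_trans (Finset.sum_le_sum fun k _ => ?_) (sum_scalarDuhamel_energy hlam w₀ hf ht s)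
  exact le_add_of_nonneg_right (intervalIntegral.integral_nonneg ht fun r _ =>
    mul_nonneg (hlam k) (sq_nonneg _))

theorem duhamel_apply {lam : ℕ → ℝ} (hlam : ∀ k, 0 ≤ lam k) (w₀ : SqSum)
    {f : ℝ → SqSum} (hf : Continuous f) {t : ℝ} (ht : 0 ≤ t) (k : ℕ) :
    duhamel lam w₀ f t k = scalarDuhamel (lam k) (w₀ k) (fun s => f s k) t :=
  toSqSum_apply (memℓp_two_of_sum_le fun N =>
    sum_scalarDuhamel_sq_le hlam w₀ hf ht (Finset.range N)) k

theorem norm_duhamel_sq_le {lam : ℕ → ℝ} (hlam : ∀ k, 0 ≤ lam k) (w₀ : SqSum)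
    {f : ℝ → SqSum} (hf : Continuous f) {t : ℝ} (ht : 0 ≤ t) :
    ‖duhamel lam w₀ f t‖ ^ 2 ≤ ‖w₀‖ ^ 2 + ∫ r in (0 : ℝ)..t, ‖f r‖ ^ 2 := by
  refine SqSum.norm_sq_le_of_sum_le fun N => ?_
  simp_rw [duhamel_apply hlam w₀ hf ht]
  exact sum_scalarDuhamel_sq_le hlam w₀ hf ht _

theorem duhamel_zero {lam : ℕ → ℝ} (hlam : ∀ k, 0 ≤ lam k) (w₀ : SqSum)
    {f : ℝ → SqSum} (hf : Continuous f) : duhamel lam w₀ f 0 = w₀ := by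
  ext k
  rw [duhamel_apply hlam w₀ hf le_rfl, scalarDuhamel_zero]

theorem duhamel_sub {lam : ℕ → ℝ} (hlam : ∀ k, 0 ≤ lam k) (w₀ : SqSum)
    {f : ℝ → SqSum} (hf : Continuous f) (w₁ : SqSum) {g : ℝ → SqSum} (hg : Continuous g)
    {t : ℝ} (ht : 0 ≤ t) :
    duhamel lam w₀ f t - duhamel lam w₁ g t = duhamel lam (w₀ - w₁) (fun s => f s - g s) t := by
  ext k
  rw [lp.coeFn_sub, Pi.sub_apply, duhamel_apply hlam w₀ hf ht, duhamel_apply hlam w₁ hg ht,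
    duhamel_apply hlam _ (f := fun s => f s - g s) (hf.sub hg) ht,
    scalarDuhamel_sub _ _ _ (continuous_coord hf k) (continuous_coord hg k)]
  rfl

theorem trunc_duhamel {lam : ℕ → ℝ} (hlam : ∀ k, 0 ≤ lam k) (w₀ : SqSum)
    {f : ℝ → SqSum} (hf : Continuous f) (N : ℕ) {t : ℝ} (ht : 0 ≤ t) :
    SqSum.trunc N (duhamel lam w₀ f t)
      = duhamel lam (SqSum.trunc N w₀) (fun s => SqSum.trunc N (f s)) t := by
  ext k
  rw [SqSum.trunc_apply, duhamel_apply hlam w₀ hf ht,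
    duhamel_apply hlam _ (f := fun s => SqSum.trunc N (f s)) ((SqSum.trunc N).continuous.comp hf)
      ht]
  simp_rw [SqSum.trunc_apply]
  split_ifs <;> simp [scalarDuhamel]

/-- Truncation commutes with the Duhamel map, so the tail of the solution solves the equation with
the tails of the data. The energy estimate makes this tail small uniformly on `[0, T]`, and finite
sums of modes are continuous. -/
theorem continuousOn_duhamel {lam : ℕ → ℝ} (hlam : ∀ k, 0 ≤ lam k) (w₀ : SqSum)
    {f : ℝ → SqSum} (hf : Continuous f) (T : ℝ) : ContinuousOn (duhamel lam w₀ f) (Icc 0 T) := by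
  have hb : ∀ N, ∀ t ∈ Icc 0 T, ‖duhamel lam w₀ f t - SqSum.trunc N (duhamel lam w₀ f t)‖ ^ 2
      ≤ ‖w₀ - SqSum.trunc N w₀‖ ^ 2 + ∫ r in (0 : ℝ)..T, ‖f r - SqSum.trunc N (f r)‖ ^ 2 := by
    intro N t ht
    have hc : Continuous fun s => f s - SqSum.trunc N (f s) :=
      hf.sub ((SqSum.trunc N).continuous.comp hf)
    rw [trunc_duhamel hlam w₀ hf N ht.1, duhamel_sub hlam w₀ hf _
      (g := fun s => SqSum.trunc N (f s)) ((SqSum.trunc N).continuous.comp hf) ht.1]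
    refine (norm_duhamel_sq_le hlam _ hc ht.1).trans ?_
    gcongr
    refine intervalIntegral.integral_mono_interval le_rfl ht.1 ht.2
      (ae_of_all _ fun r => by simp only [Pi.zero_apply]; positivity)
      ((hc.norm.pow 2).intervalIntegrable _ _)
  have hlim : Tendsto (fun N => ‖w₀ - SqSum.trunc N w₀‖ ^ 2 +
      ∫ r in (0 : ℝ)..T, ‖f r - SqSum.trunc N (f r)‖ ^ 2) atTop (𝓝 0) := by
    have h0 : ∀ v : SqSum, Tendsto (fun N => ‖v - SqSum.trunc N v‖ ^ 2) atTop (𝓝 0) := fun v => by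
      simpa using ((v.tendsto_trunc.const_sub v).norm.pow 2)
    have h1 : Tendsto (fun N => ∫ r in (0 : ℝ)..T, ‖f r - SqSum.trunc N (f r)‖ ^ 2) atTop
        (𝓝 (∫ _ in (0 : ℝ)..T, (0 : ℝ))) := by
      refine intervalIntegral.tendsto_integral_filter_of_dominated_convergence
        (fun r => ‖f r‖ ^ 2) (Eventually.of_forall fun N => ?_)
        (Eventually.of_forall fun N => ae_of_all _ fun r _ => ?_)
        ((hf.norm.pow 2).intervalIntegrable _ _) (ae_of_all _ fun r _ => h0 (f r))
      · exact (((hf.sub ((SqSum.trunc N).continuous.comp hf)).norm.pow 2)).aestronglyMeasurable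
      · rw [norm_pow, norm_norm]
        gcongr
        exact SqSum.norm_sub_trunc_le N _
    simpa using (h0 w₀).add h1
  refine continuousOn_of_uniform_approx_of_continuousOn fun u hu => ?_
  obtain ⟨ε, hε, hεu⟩ := Metric.mem_uniformity_dist.1 hu
  obtain ⟨N, hN⟩ := (hlim.eventually (gt_mem_nhds (pow_pos hε 2))).exists
  refine ⟨fun t => SqSum.trunc N (duhamel lam w₀ f t), ?_, fun t ht => hεu ?_⟩
  · have : ContinuousOn (fun t => ∑ k ∈ Finset.range N, (lp.single 2 k
        (scalarDuhamel (lam k) (w₀ k) (fun s => f s k) t) : SqSum)) (Icc 0 T) :=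
      (continuous_finsetSum _ fun k _ =>
        (lp.singleContinuousLinearMap ℝ (fun _ : ℕ => ℝ) 2 k).continuous.comp
          (continuous_scalarDuhamel _ _ (continuous_coord hf k))).continuousOn
    refine this.congr fun t ht => ?_
    simp only [SqSum.trunc_eq_sum]
    refine Finset.sum_congr rfl fun k _ => ?_
    rw [duhamel_apply hlam w₀ hf ht.1]
  · rw [dist_eq_norm]
    exact lt_of_pow_lt_pow_left₀ 2 hε.le ((hb N t ht).trans_lt hN)

/-- The energy bound, hence square-summability, is available only for `t ≥ 0`. Freezing the curve at
negative times lets the fixed point argument run in the bounded continuous functions on all of `ℝ`.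
-/
theorem continuous_duhamel_max {lam : ℕ → ℝ} (hlam : ∀ k, 0 ≤ lam k) (w₀ : SqSum)
    {f : ℝ → SqSum} (hf : Continuous f) : Continuous fun t => duhamel lam w₀ f (max t 0) := by
  rw [continuous_iff_continuousAt]
  intro t
  have h : ContinuousOn (fun t => duhamel lam w₀ f (max t 0)) (Iic (t + 1)) :=
    (continuousOn_duhamel hlam w₀ hf (max (t + 1) 0)).comp
      (continuous_id.max continuous_const).continuousOn
      fun s hs => ⟨le_max_right _ _, max_le_max_right 0 hs⟩
  exact h.continuousAt (Iic_mem_nhds (by linarith))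

/-! ### The semilinear diagonal equation -/

/-- The square of a forcing of size `M e^{κ s}` integrates to at most `M² e^{2κt} / (2κ)`. The
factor `1/(2κ)` is the source of the contraction. -/
theorem norm_duhamel_sq_le_of_exp_bound {lam : ℕ → ℝ} (hlam : ∀ k, 0 ≤ lam k) (w₀ : SqSum)
    {f : ℝ → SqSum} (hf : Continuous f) {κ M : ℝ} (hκ : 0 < κ)
    (hM : ∀ s, 0 ≤ s → ‖f s‖ ≤ M * Real.exp (κ * s)) {t : ℝ} (ht : 0 ≤ t) :
    ‖Real.exp (-κ * t) • duhamel lam w₀ f t‖ ^ 2 ≤ ‖w₀‖ ^ 2 + M ^ 2 / (2 * κ) := by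
  have h1 : ∫ r in (0 : ℝ)..t, ‖f r‖ ^ 2 ≤ M ^ 2 / (2 * κ) * Real.exp (2 * κ * t) := by
    have hd : ∀ s, HasDerivAt (fun s => M ^ 2 / (2 * κ) * Real.exp (2 * κ * s))
        ((M * Real.exp (κ * s)) ^ 2) s := fun s => by
      have := (((hasDerivAt_id s).const_mul (2 * κ)).exp).const_mul (M ^ 2 / (2 * κ))
      refine this.congr_deriv ?_
      rw [mul_pow, ← Real.exp_nat_mul]
      simp only [id]
      push_cast
      field_simp
    have hint : IntervalIntegrable (fun s => (M * Real.exp (κ * s)) ^ 2) volume 0 t :=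
      Continuous.intervalIntegrable (by fun_prop) _ _
    have h2 := intervalIntegral.integral_eq_sub_of_hasDerivAt (fun s _ => hd s) hint
    have h3 : ∫ r in (0 : ℝ)..t, ‖f r‖ ^ 2 ≤ ∫ r in (0 : ℝ)..t, (M * Real.exp (κ * r)) ^ 2 :=
      intervalIntegral.integral_mono_on ht ((hf.norm.pow 2).intervalIntegrable _ _) hint
        fun r hr => pow_le_pow_left₀ (norm_nonneg _) (hM r hr.1) 2
    have h4 : 0 ≤ M ^ 2 / (2 * κ) * Real.exp (2 * κ * 0) := by positivity
    linarith
  have h2 := norm_duhamel_sq_le hlam w₀ hf ht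
  rw [norm_smul, mul_pow, Real.norm_of_nonneg (Real.exp_pos _).le, ← Real.exp_nat_mul]
  have h5 : Real.exp (((2 : ℕ) : ℝ) * (-κ * t)) ≤ 1 := Real.exp_le_one_iff.2 (by
    push_cast; nlinarith [mul_nonneg hκ.le ht])
  have h6 : Real.exp (((2 : ℕ) : ℝ) * (-κ * t)) * Real.exp (2 * κ * t) = 1 := by
    rw [← Real.exp_add]; push_cast; ring_nf; simp
  calc Real.exp (((2 : ℕ) : ℝ) * (-κ * t)) * ‖duhamel lam w₀ f t‖ ^ 2
      ≤ Real.exp (((2 : ℕ) : ℝ) * (-κ * t)) *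
          (‖w₀‖ ^ 2 + M ^ 2 / (2 * κ) * Real.exp (2 * κ * t)) := by
        gcongr; linarith
    _ = Real.exp (((2 : ℕ) : ℝ) * (-κ * t)) * ‖w₀‖ ^ 2 + M ^ 2 / (2 * κ) := by
        rw [mul_add]; linear_combination M ^ 2 / (2 * κ) * h6
    _ ≤ _ := by
        gcongr
        exact mul_le_of_le_one_left (sq_nonneg _) h5

/-- Existence of a global mild solution of `w_k' = -λ_k w_k + √λ_k F_k(w)`. -/
theorem exists_mild_solution {lam : ℕ → ℝ} (hlam : ∀ k, 0 ≤ lam k) (w₀ : SqSum)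
    {F : SqSum → SqSum} {K : NNReal} (hF : LipschitzWith K F) :
    ∃ w : ℝ → SqSum, Continuous w ∧ ∀ t, 0 ≤ t → w t = duhamel lam w₀ (fun s => F (w s)) t := by
  -- This choice gives `K² / (2κ) ≤ 1/4`, the square of the contraction factor `1/2`.
  set κ : ℝ := 2 * (K : ℝ) ^ 2 + 1 with hκdef
  have hκ : 0 < κ := by positivity
  -- The unknown of the fixed point problem is `v s = e^{-κ s} w s`, so that the plain sup norm of
  -- `v` is the weighted norm of `w`.
  let f : BoundedContinuousFunction ℝ SqSum → ℝ → SqSum :=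
    fun v s => F (Real.exp (κ * s) • v s)
  have hfc : ∀ v, Continuous (f v) := fun v =>
    hF.continuous.comp ((by fun_prop : Continuous fun s => Real.exp (κ * s)).smul v.continuous)
  have hfb : ∀ v s, 0 ≤ s → ‖f v s‖ ≤ (K * ‖v‖ + ‖F 0‖) * Real.exp (κ * s) := fun v s hs => by
    have h1 := hF.norm_sub_le (Real.exp (κ * s) • v s) 0
    rw [sub_zero, norm_smul, Real.norm_of_nonneg (Real.exp_pos _).le] at h1
    have h2 : 1 ≤ Real.exp (κ * s) := Real.one_le_exp (by positivity)
    have h3 := v.norm_coe_le_norm s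
    have h4 := norm_le_norm_sub_add (f v s) (F 0)
    calc ‖f v s‖ ≤ K * (Real.exp (κ * s) * ‖v s‖) + ‖F 0‖ := h4.trans (by gcongr)
      _ ≤ K * (Real.exp (κ * s) * ‖v‖) + ‖F 0‖ * Real.exp (κ * s) := by
          gcongr
          exact le_mul_of_one_le_right (norm_nonneg _) h2
      _ = _ := by ring
  let Φ : BoundedContinuousFunction ℝ SqSum → BoundedContinuousFunction ℝ SqSum := fun v =>
    BoundedContinuousFunction.ofNormedAddCommGroup
      (fun t => Real.exp (-κ * max t 0) • duhamel lam w₀ (f v) (max t 0))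
      ((by fun_prop : Continuous fun t : ℝ => Real.exp (-κ * max t 0)).smul
        (continuous_duhamel_max hlam w₀ (hfc v)))
      (√(‖w₀‖ ^ 2 + (K * ‖v‖ + ‖F 0‖) ^ 2 / (2 * κ)))
      (fun t => Real.le_sqrt_of_sq_le
        (norm_duhamel_sq_le_of_exp_bound hlam w₀ (hfc v) hκ (hfb v) (le_max_right t 0)))
  have hΦ : ContractingWith (1 / 2) Φ := by
    refine ⟨by norm_num, LipschitzWith.of_dist_le_mul fun v₁ v₂ => ?_⟩
    rw [BoundedContinuousFunction.dist_le (by positivity)]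
    intro t
    have hd : ∀ s, 0 ≤ s → ‖f v₁ s - f v₂ s‖ ≤ (K * dist v₁ v₂) * Real.exp (κ * s) := fun s _ => by
      refine (hF.norm_sub_le _ _).trans ?_
      rw [← smul_sub, norm_smul, Real.norm_of_nonneg (Real.exp_pos _).le, ← dist_eq_norm]
      have := BoundedContinuousFunction.dist_coe_le_dist (f := v₁) (g := v₂) s
      calc (K : ℝ) * (Real.exp (κ * s) * dist (v₁ s) (v₂ s))
          ≤ K * (Real.exp (κ * s) * dist v₁ v₂) := by gcongr
        _ = _ := by ring
    have h1 := norm_duhamel_sq_le_of_exp_bound hlam (w₀ - w₀)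
      (f := fun s => f v₁ s - f v₂ s) ((hfc v₁).sub (hfc v₂)) hκ hd (le_max_right t 0)
    rw [← duhamel_sub hlam w₀ (hfc v₁) w₀ (hfc v₂) (le_max_right t 0), smul_sub, sub_self,
      norm_zero, ← dist_eq_norm] at h1
    change dist (Real.exp (-κ * max t 0) • duhamel lam w₀ (f v₁) (max t 0))
      (Real.exp (-κ * max t 0) • duhamel lam w₀ (f v₂) (max t 0)) ≤ _
    refine le_of_sq_le_sq (h1.trans ?_) (by positivity)
    have h2 : (K : ℝ) ^ 2 / (2 * κ) ≤ 1 / 4 := by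
      rw [div_le_div_iff₀ (by positivity) (by norm_num)]
      rw [hκdef]; nlinarith [sq_nonneg (K : ℝ)]
    have h3 := mul_le_mul_of_nonneg_right h2 (sq_nonneg (dist v₁ v₂))
    push_cast
    calc (0 : ℝ) ^ 2 + (K * dist v₁ v₂) ^ 2 / (2 * κ)
        = (K : ℝ) ^ 2 / (2 * κ) * dist v₁ v₂ ^ 2 := by ring
      _ ≤ _ := h3
      _ = _ := by ring
  have hfix : Φ hΦ.fixedPoint = hΦ.fixedPoint := hΦ.fixedPoint_isFixedPt
  set v := hΦ.fixedPoint with hv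
  refine ⟨fun t => Real.exp (κ * t) • v t,
    (by fun_prop : Continuous fun s => Real.exp (κ * s)).smul v.continuous, fun t ht => ?_⟩
  have h1 : v t = Real.exp (-κ * max t 0) • duhamel lam w₀ (f v) (max t 0) := by
    conv_lhs => rw [← hfix]
    rfl
  rw [max_eq_left ht] at h1
  change Real.exp (κ * t) • v t = duhamel lam w₀ (f v) t
  rw [h1, smul_smul, ← Real.exp_add]
  simp

theorem hasDerivAt_coord_of_mild {lam : ℕ → ℝ} (hlam : ∀ k, 0 ≤ lam k) {w₀ : SqSum}
    {f w : ℝ → SqSum} (hf : Continuous f) (hw : ∀ t, 0 ≤ t → w t = duhamel lam w₀ f t) (k : ℕ)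
    {t : ℝ} (ht : 0 < t) :
    HasDerivAt (fun t => w t k) (-lam k * w t k + √(lam k) * f t k) t := by
  have h0 : ∀ s, 0 ≤ s → w s k = scalarDuhamel (lam k) (w₀ k) (fun s => f s k) s := fun s hs => by
    rw [hw s hs, duhamel_apply hlam w₀ hf hs]
  rw [h0 t ht.le]
  refine (hasDerivAt_scalarDuhamel (lam k) (w₀ k) (continuous_coord hf k) t)
    |>.congr_of_eventuallyEq ?_
  filter_upwards [Ioi_mem_nhds ht] with s hs
  exact h0 s (le_of_lt hs)

theorem lintegral_tsum_le_of_mild {lam : ℕ → ℝ} (hlam : ∀ k, 0 ≤ lam k) {w₀ : SqSum}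
    {f w : ℝ → SqSum} (hf : Continuous f) (hw : ∀ t, 0 ≤ t → w t = duhamel lam w₀ f t)
    (hwc : Continuous w) {T : ℝ} (hT : 0 ≤ T) :
    ∫⁻ t in Ioo 0 T, ∑' k, ENNReal.ofReal (lam k * w t k ^ 2)
      ≤ ENNReal.ofReal (‖w₀‖ ^ 2 + ∫ r in (0 : ℝ)..T, ‖f r‖ ^ 2) := by
  have hcont : ∀ k, Continuous fun t => lam k * w t k ^ 2 := fun k =>
    continuous_const.mul ((continuous_coord hwc k).pow 2)
  rw [lintegral_tsum fun k => (hcont k).measurable.ennreal_ofReal.aemeasurable]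
  refine ENNReal.tsum_le_of_sum_range_le fun N => ?_
  have h1 : ∀ k, ∫⁻ t in Ioo 0 T, ENNReal.ofReal (lam k * w t k ^ 2)
      = ENNReal.ofReal (∫ t in (0 : ℝ)..T, lam k * w t k ^ 2) := fun k => by
    rw [intervalIntegral.integral_of_le hT, integral_Ioc_eq_integral_Ioo,
      ofReal_integral_eq_lintegral_ofReal]
    · exact ((hcont k).integrableOn_Icc (a := 0) (b := T)).mono_set Ioo_subset_Icc_self
    · exact ae_of_all _ fun t => mul_nonneg (hlam k) (sq_nonneg _)
  simp_rw [h1]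
  rw [← ENNReal.ofReal_sum_of_nonneg fun k _ => intervalIntegral.integral_nonneg hT fun t _ =>
    mul_nonneg (hlam k) (sq_nonneg _)]
  refine ENNReal.ofReal_le_ofReal (le_trans (Finset.sum_le_sum fun k _ => ?_)
    (sum_scalarDuhamel_energy hlam w₀ hf hT (Finset.range N)))
  refine le_trans (le_of_eq ?_) (le_add_of_nonneg_left (sq_nonneg _))
  refine intervalIntegral.integral_congr fun r hr => ?_
  rw [uIcc_of_le hT] at hr
  simp only
  rw [hw r hr.1, duhamel_apply hlam w₀ hf hr.1]

/-- The mild solution takes values in the domain of `λ^{1/2}` for almost every time. -/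
theorem ae_memℓp_of_mild {lam : ℕ → ℝ} (hlam : ∀ k, 0 ≤ lam k) {w₀ : SqSum}
    {f w : ℝ → SqSum} (hf : Continuous f) (hw : ∀ t, 0 ≤ t → w t = duhamel lam w₀ f t)
    (hwc : Continuous w) {T : ℝ} (hT : 0 ≤ T) :
    ∀ᵐ t ∂volume.restrict (Ioo 0 T), Memℓp (E := fun _ => ℝ) (fun k => √(lam k) * w t k) 2 := by
  have hfin := (lintegral_tsum_le_of_mild hlam hf hw hwc hT).trans_lt ENNReal.ofReal_lt_top
  have hm : Measurable fun t => ∑' k, ENNReal.ofReal (lam k * w t k ^ 2) :=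
    Measurable.tsum fun k =>
      (continuous_const.mul ((continuous_coord hwc k).pow 2)).measurable.ennreal_ofReal
  filter_upwards [ae_lt_top hm hfin.ne] with t ht
  rw [memℓp_two_iff]
  have h1 := ENNReal.summable_toReal ht.ne
  refine h1.congr fun k => ?_
  rw [ENNReal.toReal_ofReal (mul_nonneg (hlam k) (sq_nonneg _)), mul_pow, Real.sq_sqrt (hlam k)]

/-- For `λ = eigval ν L` the numbers `√λ_k w_k` are the coefficients of `u - ν u_xx`, so this is the
`L²(0, T; H²)` regularity. The sequence is square-summable only for almost every time; measurability
is inherited from the finite truncations. -/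
theorem memLp_of_mild {lam : ℕ → ℝ} (hlam : ∀ k, 0 ≤ lam k) {w₀ : SqSum}
    {f w : ℝ → SqSum} (hf : Continuous f) (hw : ∀ t, 0 ≤ t → w t = duhamel lam w₀ f t)
    (hwc : Continuous w) {T : ℝ} (hT : 0 ≤ T) :
    MemLp (fun t => toSqSum fun k => √(lam k) * w t k) 2 (volume.restrict (Ioo 0 T)) := by
  have hae := ae_memℓp_of_mild hlam hf hw hwc hT
  have hmeas : AEStronglyMeasurable (fun t => toSqSum fun k => √(lam k) * w t k)
      (volume.restrict (Ioo 0 T)) := by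
    refine aestronglyMeasurable_of_tendsto_ae atTop
      (f := fun N t => ∑ k ∈ Finset.range N, (lp.single 2 k (√(lam k) * w t k) : SqSum))
      (fun N => ?_) ?_
    · refine Continuous.aestronglyMeasurable (continuous_finsetSum _ fun k _ => ?_)
      exact (lp.singleContinuousLinearMap ℝ (fun _ : ℕ => ℝ) 2 k).continuous.comp
        (continuous_const.mul (continuous_coord hwc k))
    · filter_upwards [hae] with t ht
      have := (toSqSum fun k => √(lam k) * w t k).tendsto_trunc
      simp_rw [SqSum.trunc_eq_sum, toSqSum_apply ht] at this
      exact this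
  rw [memLp_two_iff_integrable_sq_norm hmeas]
  refine ⟨hmeas.norm.pow 2, ?_⟩
  refine lt_of_le_of_lt (le_of_eq ?_)
    ((lintegral_tsum_le_of_mild hlam hf hw hwc hT).trans_lt ENNReal.ofReal_lt_top)
  refine lintegral_congr_ae ?_
  filter_upwards [hae] with t ht
  have h2 := (toSqSum fun k => √(lam k) * w t k).hasSum_sq
  simp_rw [toSqSum_apply ht, mul_pow, Real.sq_sqrt (hlam _)] at h2
  rw [← ENNReal.ofReal_tsum_of_nonneg (fun k => mul_nonneg (hlam k) (sq_nonneg _)) h2.summable,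
    h2.tsum_eq, Real.enorm_of_nonneg (sq_nonneg _)]

/-! ### Smooth cut-off functions on `(0, L)` -/

theorem exists_bound_deriv_smoothTransition :
    ∃ C : ℝ, 0 ≤ C ∧ ∀ x, |deriv Real.smoothTransition x| ≤ C := by
  have hc : Continuous (deriv Real.smoothTransition) :=
    (Real.smoothTransition.contDiff (n := 1)).continuous_deriv le_rfl
  have h0 : ∀ x, x ∉ Icc (0 : ℝ) 1 → deriv Real.smoothTransition x = 0 := by
    intro x hx
    rw [mem_Icc, not_and_or, not_le, not_le] at hx
    rcases hx with hx | hx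
    · have : Real.smoothTransition =ᶠ[𝓝 x] fun _ => 0 := by
        filter_upwards [Iio_mem_nhds hx] with y hy
        exact Real.smoothTransition.zero_of_nonpos (le_of_lt hy)
      rw [this.deriv_eq]; simp
    · have : Real.smoothTransition =ᶠ[𝓝 x] fun _ => 1 := by
        filter_upwards [Ioi_mem_nhds hx] with y hy
        exact Real.smoothTransition.one_of_one_le (le_of_lt hy)
      rw [this.deriv_eq]; simp
  obtain ⟨C, hC⟩ := (HasCompactSupport.intro isCompact_Icc h0).exists_bound_of_continuous hc
  exact ⟨C, (norm_nonneg _).trans (hC 0), hC⟩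

/-- A smooth function which vanishes outside of `[1/n, L - 1/n]` and is `1` on
`[2/n, L - 2/n]`. -/
def cutoff (L : ℝ) (n : ℕ) (x : ℝ) : ℝ :=
  Real.smoothTransition (n * x - 1) * Real.smoothTransition (n * (L - x) - 1)

theorem contDiff_cutoff (L : ℝ) (n : ℕ) : ContDiff ℝ ∞ (cutoff L n) := by
  unfold cutoff
  refine ContDiff.mul (Real.smoothTransition.contDiff.comp ?_)
    (Real.smoothTransition.contDiff.comp ?_) <;> fun_prop

theorem cutoff_nonneg (L : ℝ) (n : ℕ) (x : ℝ) : 0 ≤ cutoff L n x :=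
  mul_nonneg (Real.smoothTransition.nonneg _) (Real.smoothTransition.nonneg _)

theorem cutoff_le_one (L : ℝ) (n : ℕ) (x : ℝ) : cutoff L n x ≤ 1 :=
  mul_le_one₀ (Real.smoothTransition.le_one _) (Real.smoothTransition.nonneg _)
    (Real.smoothTransition.le_one _)

theorem cutoff_eq_one {L : ℝ} {n : ℕ} {x : ℝ} (h1 : 2 ≤ n * x) (h2 : 2 ≤ n * (L - x)) :
    cutoff L n x = 1 := by
  rw [cutoff, Real.smoothTransition.one_of_one_le (by linarith),
    Real.smoothTransition.one_of_one_le (by linarith), one_mul]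

theorem tsupport_cutoff_subset {L : ℝ} {n : ℕ} (hn : 0 < n) :
    tsupport (cutoff L n) ⊆ Icc (1 / n : ℝ) (L - 1 / n) := by
  have hn' : (0 : ℝ) < n := by exact_mod_cast hn
  refine closure_minimal (fun x hx => ?_) isClosed_Icc
  by_contra hc
  rw [mem_Icc, not_and_or, not_le, not_le] at hc
  refine hx ?_
  rcases hc with hc | hc
  · rw [lt_div_iff₀ hn'] at hc
    rw [cutoff, Real.smoothTransition.zero_of_nonpos (by linarith), zero_mul]
  · have : L - x < 1 / n := by linarith
    rw [lt_div_iff₀ hn'] at this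
    rw [cutoff, Real.smoothTransition.zero_of_nonpos (x := n * (L - x) - 1) (by linarith),
      mul_zero]

theorem deriv_cutoff_eq_zero {L : ℝ} {n : ℕ} {x : ℝ} (h1 : 2 < n * x) (h2 : 2 < n * (L - x)) :
    deriv (cutoff L n) x = 0 := by
  have : cutoff L n =ᶠ[𝓝 x] fun _ => 1 := by
    have e1 : ∀ᶠ y in 𝓝 x, 2 < (n : ℝ) * y :=
      (by fun_prop : Continuous fun y : ℝ => n * y).continuousAt.eventually (lt_mem_nhds h1)
    have e2 : ∀ᶠ y in 𝓝 x, 2 < (n : ℝ) * (L - y) :=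
      (by fun_prop : Continuous fun y : ℝ => n * (L - y)).continuousAt.eventually (lt_mem_nhds h2)
    filter_upwards [e1, e2] with y h1 h2 using cutoff_eq_one h1.le h2.le
  rw [this.deriv_eq]; simp

theorem exists_bound_deriv_cutoff :
    ∃ C : ℝ, 0 ≤ C ∧ ∀ L n x, |deriv (cutoff L n) x| ≤ C * n := by
  obtain ⟨C, hC0, hC⟩ := exists_bound_deriv_smoothTransition
  refine ⟨2 * C, by positivity, fun L n x => ?_⟩
  have hd : ∀ y, HasDerivAt Real.smoothTransition (deriv Real.smoothTransition y) y := fun y =>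
    ((Real.smoothTransition.contDiff (n := 1)).differentiable one_ne_zero y).hasDerivAt
  have h1 : HasDerivAt (fun x : ℝ => n * x - 1) n x := by
    simpa using ((hasDerivAt_id x).const_mul (n : ℝ)).sub_const 1
  have h2 : HasDerivAt (fun x : ℝ => n * (L - x) - 1) (-n) x := by
    simpa using (((hasDerivAt_id x).const_sub L).const_mul (n : ℝ)).sub_const 1
  have h3 : HasDerivAt (cutoff L n) _ x := ((hd _).comp x h1).mul ((hd _).comp x h2)
  rw [h3.deriv]
  have a1 := hC (n * x - 1)
  have a2 := hC (n * (L - x) - 1)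
  have b : ∀ y, |Real.smoothTransition y| ≤ 1 := fun y => by
    rw [abs_of_nonneg (Real.smoothTransition.nonneg y)]; exact Real.smoothTransition.le_one y
  have hn : |(n : ℝ)| = n := abs_of_nonneg (Nat.cast_nonneg n)
  refine (abs_add_le _ _).trans ?_
  simp only [abs_mul, abs_neg, hn, Function.comp_apply]
  have c1 : |deriv Real.smoothTransition (n * x - 1)| * n *
      |Real.smoothTransition (n * (L - x) - 1)| ≤ C * n * 1 := by
    gcongr
    exact b _
  have c2 : |Real.smoothTransition (n * x - 1)| *
      (|deriv Real.smoothTransition (n * (L - x) - 1)| * n) ≤ 1 * (C * n) := by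
    gcongr
    exact b _
  linarith

theorem eventually_two_lt_mul {x : ℝ} (hx : 0 < x) : ∀ᶠ n : ℕ in atTop, 2 < (n : ℝ) * x :=
  (tendsto_natCast_atTop_atTop.atTop_mul_const hx).eventually_gt_atTop 2

/-! ### Testing weak derivatives against functions without compact support -/

/-- The product of `ψ` and the cut-off is an admissible test function. The only term that does not
converge by itself has the derivative on the cut-off: it is of size `n` on boundary layers of width
`2/n`. The next two theorems remove it, by smallness of `ψ` or of `f` in the layers. -/
theorem integral_mul_deriv_eq_of_tendsto_cutoff {L : ℝ} {f g : L2 L} (h : IsWeakDeriv L f g)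
    {ψ : ℝ → ℝ} (hψ : ContDiff ℝ ∞ ψ)
    (hlim : Tendsto (fun n : ℕ => ∫ x in Ioo 0 L, f x * (ψ x * deriv (cutoff L n) x))
      atTop (𝓝 0)) :
    ∫ x in Ioo 0 L, f x * deriv ψ x = -∫ x in Ioo 0 L, g x * ψ x := by
  have hint : ∀ (k : L2 L) {φ : ℝ → ℝ}, Continuous φ →
      Integrable (fun x => k x * φ x) (volume.restrict (Ioo (0 : ℝ) L)) := by
    intro k φ hφ
    obtain ⟨C, hC⟩ := isCompact_Icc.exists_bound_of_continuousOn
      (hφ.continuousOn (s := Icc (0 : ℝ) L))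
    refine ((Lp.memLp k).integrable (by norm_num)).mul_bdd (c := C) hφ.aestronglyMeasurable ?_
    filter_upwards [ae_restrict_mem measurableSet_Ioo] with x hx
    exact hC x (Ioo_subset_Icc_self hx)
  have hcut : ∀ (k : L2 L) {φ : ℝ → ℝ}, Continuous φ →
      Tendsto (fun n : ℕ => ∫ x in Ioo 0 L, k x * (φ x * cutoff L n x)) atTop
        (𝓝 (∫ x in Ioo 0 L, k x * φ x)) := by
    intro k φ hφ
    refine tendsto_integral_of_dominated_convergence (fun x => |k x * φ x|) (fun n => ?_)
      (hint k hφ).abs (fun n => ae_of_all _ fun x => ?_) ?_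
    · exact (hint k (hφ.mul (contDiff_cutoff L n).continuous)).aestronglyMeasurable
    · rw [← mul_assoc, norm_mul, Real.norm_eq_abs, Real.norm_of_nonneg (cutoff_nonneg L n x)]
      exact mul_le_of_le_one_right (abs_nonneg _) (cutoff_le_one L n x)
    · filter_upwards [ae_restrict_mem measurableSet_Ioo] with x hx
      refine tendsto_const_nhds.congr' ?_
      filter_upwards [eventually_two_lt_mul hx.1, eventually_two_lt_mul (sub_pos.2 hx.2)]
        with n h1 h2
      rw [cutoff_eq_one h1.le h2.le, mul_one]
  have hid : ∀ᶠ n : ℕ in atTop, (∫ x in Ioo 0 L, f x * (deriv ψ x * cutoff L n x)) +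
      ∫ x in Ioo 0 L, f x * (ψ x * deriv (cutoff L n) x)
      = -∫ x in Ioo 0 L, g x * (ψ x * cutoff L n x) := by
    filter_upwards [eventually_gt_atTop 0] with n hn
    have hn' : (0 : ℝ) < 1 / n := by positivity
    have hsub := (tsupport_mul_subset_right (f := ψ) (g := cutoff L n)).trans
      (tsupport_cutoff_subset (L := L) hn)
    have ht := h (fun x => ψ x * cutoff L n x) (hψ.mul (contDiff_cutoff L n))
      (isCompact_Icc.of_isClosed_subset (isClosed_tsupport _) hsub)
      (hsub.trans (Icc_subset_Ioo hn' (by linarith)))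
    have i1 := hint f (φ := fun x => deriv ψ x * cutoff L n x)
      ((hψ.continuous_deriv (by simp)).mul (contDiff_cutoff L n).continuous)
    have i2 := hint f (φ := fun x => ψ x * deriv (cutoff L n) x)
      (hψ.continuous.mul ((contDiff_cutoff L n).continuous_deriv (by simp)))
    rw [← ht, ← integral_add i1 i2]
    refine integral_congr_ae (ae_of_all _ fun x => ?_)
    have e : HasDerivAt (fun x => ψ x * cutoff L n x) _ x :=
      ((hψ.differentiable (by simp)) x).hasDerivAt.mul
        (((contDiff_cutoff L n).differentiable (by simp)) x).hasDerivAt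
    simp only
    rw [e.deriv]
    ring
  have l1 := (hcut f (hψ.continuous_deriv (by simp))).add hlim
  have l2 := (hcut g hψ.continuous).neg
  rw [add_zero] at l1
  exact tendsto_nhds_unique (l1.congr' hid) l2

/-- In the boundary layers `|ψ| ≤ 2M/n` by the mean value inequality, which cancels the factor `n`
from the cut-off. The integrand is then dominated by a multiple of `|f|` and tends to zero
pointwise. -/
theorem IsWeakDeriv.integral_mul_deriv_of_test_eq_zero {L : ℝ} {f g : L2 L}
    (h : IsWeakDeriv L f g) {ψ : ℝ → ℝ} (hψ : ContDiff ℝ ∞ ψ) (h0 : ψ 0 = 0) (hL : ψ L = 0) :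
    ∫ x in Ioo 0 L, f x * deriv ψ x = -∫ x in Ioo 0 L, g x * ψ x := by
  refine integral_mul_deriv_eq_of_tendsto_cutoff h hψ ?_
  obtain ⟨C, hC0, hC⟩ := exists_bound_deriv_cutoff
  obtain ⟨M, hM⟩ := isCompact_Icc.exists_bound_of_continuousOn
    ((hψ.continuous_deriv (by simp)).continuousOn (s := Icc (0 : ℝ) L))
  have hlip : ∀ x ∈ Icc 0 L, ∀ y ∈ Icc 0 L, |ψ y - ψ x| ≤ M * |y - x| := fun x hx y hy =>
    (convex_Icc 0 L).norm_image_sub_le_of_norm_deriv_le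
      (fun z _ => hψ.differentiable (by simp) z) hM hx hy
  suffices Tendsto (fun n : ℕ => ∫ x in Ioo 0 L, f x * (ψ x * deriv (cutoff L n) x))
      atTop (𝓝 (∫ _ in Ioo 0 L, (0 : ℝ))) by simpa using this
  refine tendsto_integral_of_dominated_convergence (fun x => |f x| * (2 * M * C)) (fun n => ?_)
    (((Lp.memLp f).integrable (by norm_num)).abs.mul_const _)
    (fun n => ?_) ?_
  · exact (Lp.aestronglyMeasurable f).mul (hψ.continuous.mul
      ((contDiff_cutoff L n).continuous_deriv (by simp))).aestronglyMeasurable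
  · filter_upwards [ae_restrict_mem measurableSet_Ioo] with x hx
    rw [norm_mul, Real.norm_eq_abs]
    have hx' := Ioo_subset_Icc_self hx
    have hLp : 0 ≤ L := (hx.1.trans hx.2).le
    have hM0 : 0 ≤ M := (norm_nonneg _).trans (hM x hx')
    refine mul_le_mul_of_nonneg_left ?_ (abs_nonneg _)
    by_cases hc : 2 < n * x ∧ 2 < n * (L - x)
    · rw [deriv_cutoff_eq_zero hc.1 hc.2, mul_zero, norm_zero]; positivity
    · rw [norm_mul, Real.norm_eq_abs, Real.norm_eq_abs]
      have b1 := hlip 0 (left_mem_Icc.2 hLp) x hx'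
      have b2 := hlip L (right_mem_Icc.2 hLp) x hx'
      rw [h0, sub_zero, sub_zero, abs_of_pos hx.1] at b1
      rw [hL, sub_zero, abs_sub_comm, abs_of_pos (sub_pos.2 hx.2)] at b2
      have b3 := hC L n x
      have b4 : n * |ψ x| ≤ 2 * M := by
        rw [not_and_or, not_lt, not_lt] at hc
        have hn0 : (0 : ℝ) ≤ n := Nat.cast_nonneg n
        rcases hc with hc | hc
        · calc n * |ψ x| ≤ n * (M * x) := by gcongr
            _ = M * (n * x) := by ring
            _ ≤ M * 2 := by gcongr
            _ = 2 * M := by ring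
        · calc n * |ψ x| ≤ n * (M * (L - x)) := by gcongr
            _ = M * (n * (L - x)) := by ring
            _ ≤ M * 2 := by gcongr
            _ = 2 * M := by ring
      calc |ψ x| * |deriv (cutoff L n) x| ≤ |ψ x| * (C * n) := by gcongr
        _ = n * |ψ x| * C := by ring
        _ ≤ 2 * M * C := by gcongr
  · filter_upwards [ae_restrict_mem measurableSet_Ioo] with x hx
    refine tendsto_const_nhds.congr' ?_
    filter_upwards [eventually_two_lt_mul hx.1, eventually_two_lt_mul (sub_pos.2 hx.2)]
      with n h1 h2
    rw [deriv_cutoff_eq_zero h1 h2]; simp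

/-- Here `ψ` is arbitrary at the ends and `f` provides the smallness: `|f| ≤ η` in layers of total
measure at most `4/n`, against a cut-off derivative of size `C n`. -/
theorem IsWeakDeriv.integral_mul_deriv_of_vanishesAtEndpoints {L : ℝ} (hLpos : 0 < L) {f g : L2 L}
    (h : IsWeakDeriv L f g) (hv : VanishesAtEndpoints L f) {ψ : ℝ → ℝ} (hψ : ContDiff ℝ ∞ ψ) :
    ∫ x in Ioo 0 L, f x * deriv ψ x = -∫ x in Ioo 0 L, g x * ψ x := by
  refine integral_mul_deriv_eq_of_tendsto_cutoff h hψ ?_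
  obtain ⟨C, hC0, hC⟩ := exists_bound_deriv_cutoff
  obtain ⟨M, hM⟩ := isCompact_Icc.exists_bound_of_continuousOn
    (hψ.continuous.continuousOn (s := Icc (0 : ℝ) L))
  obtain ⟨G, hGc, hfG, hG0, hGL⟩ := hv
  have hM0 : 0 ≤ M := (norm_nonneg _).trans (hM 0 (left_mem_Icc.2 hLpos.le))
  rw [Metric.tendsto_atTop]
  intro ε hε
  -- The final bound is `η * (4 * M * C)`. The `+ 1` makes it strictly less than `ε` and excludes a
  -- zero denominator.
  set η : ℝ := ε / (4 * M * C + 1) with hη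
  have hηpos : 0 < η := by positivity
  obtain ⟨δ₁, hδ₁, h1⟩ := Metric.continuousOn_iff.1 hGc 0 (left_mem_Icc.2 hLpos.le) η hηpos
  obtain ⟨δ₂, hδ₂, h2⟩ := Metric.continuousOn_iff.1 hGc L (right_mem_Icc.2 hLpos.le) η hηpos
  obtain ⟨N, hN⟩ := eventually_atTop.1 ((eventually_two_lt_mul hδ₁).and
    ((eventually_two_lt_mul hδ₂).and (eventually_gt_atTop 0)))
  refine ⟨N, fun n hn => ?_⟩
  obtain ⟨hn1, hn2, hn3⟩ := hN n hn
  have hn0 : (0 : ℝ) < n := by exact_mod_cast hn3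
  let S : Set ℝ := Icc 0 (2 / n) ∪ Icc (L - 2 / n) L
  have hS : MeasurableSet S := measurableSet_Icc.union measurableSet_Icc
  have hvol : volume.real S ≤ 4 / n := by
    refine (measureReal_union_le _ _).trans ?_
    rw [Real.volume_real_Icc, Real.volume_real_Icc]
    rw [max_eq_left (by rw [sub_zero]; positivity),
      max_eq_left (by rw [sub_sub_cancel]; positivity)]
    apply le_of_eq; ring
  have hfin : volume S ≠ ⊤ := ((measure_union_le _ _).trans_lt (by simp)).ne
  have hbound : ∀ᵐ x ∂volume.restrict (Ioo 0 L),
      ‖f x * (ψ x * deriv (cutoff L n) x)‖ ≤ S.indicator (fun _ => η * (M * (C * n))) x := by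
    filter_upwards [ae_restrict_mem measurableSet_Ioo, hfG] with x hx hxG
    have hx' := Ioo_subset_Icc_self hx
    by_cases hc : 2 < n * x ∧ 2 < n * (L - x)
    · rw [deriv_cutoff_eq_zero hc.1 hc.2, mul_zero, mul_zero, norm_zero]
      exact indicator_nonneg (fun _ _ => by positivity) x
    · have hb : |G x| ≤ η ∧ x ∈ S := by
        rw [not_and_or, not_lt, not_lt] at hc
        rcases hc with hc | hc
        · have hx2 : x ≤ 2 / n := by rw [le_div_iff₀ hn0]; linarith
          have hx3 : x < δ₁ := by
            by_contra hcon
            have := mul_le_mul_of_nonneg_left (not_lt.1 hcon) hn0.le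
            linarith
          have := h1 x hx' (by rw [Real.dist_eq, sub_zero, abs_of_pos hx.1]; exact hx3)
          rw [Real.dist_eq, hG0, sub_zero] at this
          exact ⟨this.le, Or.inl ⟨hx.1.le, hx2⟩⟩
        · have hx2 : L - x ≤ 2 / n := by rw [le_div_iff₀ hn0]; linarith
          have hx3 : L - x < δ₂ := by
            by_contra hcon
            have := mul_le_mul_of_nonneg_left (not_lt.1 hcon) hn0.le
            linarith
          have := h2 x hx' (by
            rw [Real.dist_eq, abs_sub_comm, abs_of_pos (sub_pos.2 hx.2)]; exact hx3)
          rw [Real.dist_eq, hGL, sub_zero] at this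
          exact ⟨this.le, Or.inr ⟨by linarith, hx.2.le⟩⟩
      rw [indicator_of_mem hb.2, norm_mul, norm_mul, hxG]
      have e1 := hM x hx'
      have e2 := hC L n x
      simp only [Real.norm_eq_abs] at e1 ⊢
      have e3 := hb.1
      gcongr
  have hindint : Integrable (S.indicator fun _ => η * (M * (C * n))) (volume : Measure ℝ) :=
    (integrable_indicator_iff hS).2 (integrableOn_const (μ := volume) hfin)
  rw [dist_zero_right]
  calc ‖∫ x in Ioo 0 L, f x * (ψ x * deriv (cutoff L n) x)‖
      ≤ ∫ x in Ioo 0 L, S.indicator (fun _ => η * (M * (C * n))) x :=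
        norm_integral_le_of_norm_le hindint.restrict hbound
    _ ≤ ∫ x, S.indicator (fun _ => η * (M * (C * n))) x :=
        setIntegral_le_integral hindint
          (ae_of_all _ fun x => indicator_nonneg (fun _ _ => by positivity) x)
    _ = volume.real S * (η * (M * (C * n))) := by
        rw [integral_indicator hS, setIntegral_const, smul_eq_mul]
    _ ≤ 4 / n * (η * (M * (C * n))) := by gcongr
    _ = η * (4 * M * C) := by field_simp
    _ < η * (4 * M * C + 1) := by gcongr; linarith
    _ = ε := by rw [hη]; field_simp

/-! ### Bounded continuous functions in `L²(0, L)` -/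

/-- The class in `L²(0, L)` of a bounded continuous function. -/
def toL2 (L : ℝ) : BoundedContinuousFunction ℝ ℝ →L[ℝ] L2 L :=
  BoundedContinuousFunction.toLp 2 (volume.restrict (Ioo (0 : ℝ) L)) ℝ

theorem coeFn_toL2 (L : ℝ) (φ : BoundedContinuousFunction ℝ ℝ) :
    toL2 L φ =ᵐ[volume.restrict (Ioo 0 L)] φ :=
  BoundedContinuousFunction.coeFn_toLp 2 (volume.restrict (Ioo (0 : ℝ) L)) ℝ φ

theorem inner_eq_integral {L : ℝ} (f g : L2 L) :
    inner ℝ f g = ∫ x in Ioo 0 L, f x * g x := by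
  rw [L2.inner_def]
  refine integral_congr_ae (ae_of_all _ fun x => ?_)
  simp [mul_comm]

theorem inner_toL2_right {L : ℝ} (f : L2 L) (φ : BoundedContinuousFunction ℝ ℝ) :
    inner ℝ f (toL2 L φ) = ∫ x in Ioo 0 L, f x * φ x := by
  rw [inner_eq_integral]
  refine integral_congr_ae ?_
  filter_upwards [coeFn_toL2 L φ] with x hx
  rw [hx]

theorem isWeakDeriv_toL2 {L : ℝ} (hL : 0 < L) {φ φ' : BoundedContinuousFunction ℝ ℝ}
    (h : ∀ x, HasDerivAt φ (φ' x) x) : IsWeakDeriv L (toL2 L φ) (toL2 L φ') := by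
  intro ψ hψ hc hs
  have e : ∀ (θ : BoundedContinuousFunction ℝ ℝ) (χ : ℝ → ℝ),
      ∫ x in Ioo 0 L, toL2 L θ x * χ x = ∫ x in (0 : ℝ)..L, θ x * χ x := by
    intro θ χ
    rw [intervalIntegral.integral_of_le hL.le, integral_Ioc_eq_integral_Ioo]
    refine integral_congr_ae ?_
    filter_upwards [coeFn_toL2 L θ] with x hx
    rw [hx]
  have hz : ∀ x, x ∉ Ioo 0 L → ψ x = 0 := fun x hx =>
    image_eq_zero_of_notMem_tsupport fun h' => hx (hs h')
  rw [e, e, intervalIntegral.integral_mul_deriv_eq_deriv_mul (fun x _ => h x)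
    (fun x _ => (hψ.differentiable (by simp) x).hasDerivAt)
    (φ'.continuous.intervalIntegrable _ _)
    ((hψ.continuous_deriv (by simp)).intervalIntegrable _ _), hz 0 (by simp), hz L (by simp)]
  simp

theorem IsWeakDeriv.inner_of_test_eq_zero {L : ℝ} {f g : L2 L} (hfg : IsWeakDeriv L f g)
    {ψ ψ' : BoundedContinuousFunction ℝ ℝ} (hψ : ContDiff ℝ ∞ ψ)
    (h : ∀ x, HasDerivAt ψ (ψ' x) x) (h0 : ψ 0 = 0) (hL : ψ L = 0) :
    inner ℝ f (toL2 L ψ') = -inner ℝ g (toL2 L ψ) := by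
  rw [inner_toL2_right, inner_toL2_right, ← hfg.integral_mul_deriv_of_test_eq_zero hψ h0 hL]
  simp_rw [(h _).deriv]

theorem IsWeakDeriv.inner_of_vanishesAtEndpoints {L : ℝ} (hLpos : 0 < L) {f g : L2 L}
    (hfg : IsWeakDeriv L f g) (hv : VanishesAtEndpoints L f)
    {ψ ψ' : BoundedContinuousFunction ℝ ℝ} (hψ : ContDiff ℝ ∞ ψ)
    (h : ∀ x, HasDerivAt ψ (ψ' x) x) :
    inner ℝ f (toL2 L ψ') = -inner ℝ g (toL2 L ψ) := by
  rw [inner_toL2_right, inner_toL2_right,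
    ← hfg.integral_mul_deriv_of_vanishesAtEndpoints hLpos hv hψ]
  simp_rw [(h _).deriv]

/-- The weak derivative is a closed operator. -/
theorem IsWeakDeriv.of_tendsto {L : ℝ} {f g : L2 L} {fn gn : ℕ → L2 L}
    (h : ∀ n, IsWeakDeriv L (fn n) (gn n)) (hf : Tendsto fn atTop (𝓝 f))
    (hg : Tendsto gn atTop (𝓝 g)) : IsWeakDeriv L f g := by
  intro ψ hψ hc hs
  have hcd : Continuous (deriv ψ) := hψ.continuous_deriv (by simp)
  obtain ⟨C, hC⟩ := hc.exists_bound_of_continuous hψ.continuous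
  obtain ⟨C', hC'⟩ := hc.deriv.exists_bound_of_continuous hcd
  let φ := BoundedContinuousFunction.ofNormedAddCommGroup ψ hψ.continuous C hC
  let φ' := BoundedContinuousFunction.ofNormedAddCommGroup (deriv ψ) hcd C' hC'
  have e : ∀ n, inner ℝ (fn n) (toL2 L φ') = -inner ℝ (gn n) (toL2 L φ) := fun n => by
    rw [inner_toL2_right, inner_toL2_right]
    exact h n ψ hψ hc hs
  have := tendsto_nhds_unique ((hf.inner tendsto_const_nhds).congr e)
    (hg.inner tendsto_const_nhds).neg
  rw [inner_toL2_right, inner_toL2_right] at this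
  exact this

/-! ### The cosine basis -/

/-- The frequency `kπ/L`. -/
def freq (L : ℝ) (k : ℕ) : ℝ := k * Real.pi / L

/-- The normalising factor of the `k`-th cosine in `L²(0, L)`. -/
def cosCoeff (L : ℝ) (k : ℕ) : ℝ := if k = 0 then √(1 / L) else √(2 / L)

theorem cosCoeff_pos {L : ℝ} (hL : 0 < L) (k : ℕ) : 0 < cosCoeff L k := by
  unfold cosCoeff; split_ifs <;> positivity

theorem cosCoeff_le {L : ℝ} (hL : 0 < L) (k : ℕ) : cosCoeff L k ≤ √(2 / L) := by
  unfold cosCoeff; split_ifs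
  · exact Real.sqrt_le_sqrt (by gcongr; norm_num)
  · exact le_rfl

/-- `x ↦ cos (kπx/L)` -/
def rawCos (L : ℝ) (k : ℕ) : BoundedContinuousFunction ℝ ℝ :=
  BoundedContinuousFunction.ofNormedAddCommGroup (fun x => Real.cos (freq L k * x))
    (by fun_prop) 1 fun x => Real.abs_cos_le_one _

/-- `x ↦ sin (kπx/L)` -/
def rawSin (L : ℝ) (k : ℕ) : BoundedContinuousFunction ℝ ℝ :=
  BoundedContinuousFunction.ofNormedAddCommGroup (fun x => Real.sin (freq L k * x))
    (by fun_prop) 1 fun x => Real.abs_sin_le_one _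

theorem rawCos_apply (L : ℝ) (k : ℕ) (x : ℝ) : rawCos L k x = Real.cos (freq L k * x) := rfl

/-- The `k`-th normalised Neumann eigenfunction. -/
def cosFun (L : ℝ) (k : ℕ) : BoundedContinuousFunction ℝ ℝ := cosCoeff L k • rawCos L k

/-- The derivative of `cosFun L k`. -/
def dcosFun (L : ℝ) (k : ℕ) : BoundedContinuousFunction ℝ ℝ :=
  -(cosCoeff L k * freq L k) • rawSin L k

theorem cosFun_apply (L : ℝ) (k : ℕ) (x : ℝ) :
    cosFun L k x = cosCoeff L k * Real.cos (freq L k * x) := rfl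

theorem dcosFun_apply (L : ℝ) (k : ℕ) (x : ℝ) :
    dcosFun L k x = -(cosCoeff L k * freq L k) * Real.sin (freq L k * x) := rfl

theorem norm_cosFun_le {L : ℝ} (hL : 0 < L) (k : ℕ) : ‖cosFun L k‖ ≤ √(2 / L) := by
  rw [BoundedContinuousFunction.norm_le (by positivity)]
  intro x
  rw [cosFun_apply, norm_mul, Real.norm_of_nonneg (cosCoeff_pos hL k).le]
  exact (mul_le_of_le_one_right (cosCoeff_pos hL k).le (Real.abs_cos_le_one _)).trans
    (cosCoeff_le hL k)

theorem norm_dcosFun_le {L : ℝ} (hL : 0 < L) (k : ℕ) :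
    ‖dcosFun L k‖ ≤ √(2 / L) * freq L k := by
  have hf : 0 ≤ freq L k := by unfold freq; positivity
  rw [BoundedContinuousFunction.norm_le (by positivity)]
  intro x
  rw [dcosFun_apply, norm_mul, norm_neg, norm_mul, Real.norm_of_nonneg (cosCoeff_pos hL k).le,
    Real.norm_of_nonneg hf]
  refine (mul_le_of_le_one_right (mul_nonneg (cosCoeff_pos hL k).le hf)
    (Real.abs_sin_le_one _)).trans ?_
  gcongr
  exact cosCoeff_le hL k

theorem hasDerivAt_cosFun (L : ℝ) (k : ℕ) (x : ℝ) :
    HasDerivAt (cosFun L k) (dcosFun L k x) x := by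
  have h := (((hasDerivAt_id x).const_mul (freq L k)).cos).const_mul (cosCoeff L k)
  refine h.congr_deriv ?_
  rw [dcosFun_apply]; simp only [id]; ring

theorem hasDerivAt_dcosFun (L : ℝ) (k : ℕ) (x : ℝ) :
    HasDerivAt (dcosFun L k) ((-(freq L k ^ 2) • cosFun L k) x) x := by
  have h := (((hasDerivAt_id x).const_mul (freq L k)).sin).const_mul
    (-(cosCoeff L k * freq L k))
  refine h.congr_deriv ?_
  rw [BoundedContinuousFunction.smul_apply, cosFun_apply]; simp only [id, smul_eq_mul]; ring

theorem contDiff_cosFun (L : ℝ) (k : ℕ) : ContDiff ℝ ∞ (cosFun L k) :=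
  contDiff_const.mul (Real.contDiff_cos.comp (contDiff_const.mul contDiff_id))

theorem contDiff_dcosFun (L : ℝ) (k : ℕ) : ContDiff ℝ ∞ (dcosFun L k) :=
  contDiff_const.mul (Real.contDiff_sin.comp (contDiff_const.mul contDiff_id))

theorem dcosFun_zero (L : ℝ) (k : ℕ) : dcosFun L k 0 = 0 := by
  rw [dcosFun_apply]; simp

theorem dcosFun_right {L : ℝ} (hL : 0 < L) (k : ℕ) : dcosFun L k L = 0 := by
  rw [dcosFun_apply, freq, div_mul_cancel₀ _ hL.ne', Real.sin_nat_mul_pi, mul_zero]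

theorem isWeakDeriv_cosFun {L : ℝ} (hL : 0 < L) (k : ℕ) :
    IsWeakDeriv L (toL2 L (cosFun L k)) (toL2 L (dcosFun L k)) :=
  isWeakDeriv_toL2 hL (hasDerivAt_cosFun L k)

theorem isWeakDeriv_dcosFun {L : ℝ} (hL : 0 < L) (k : ℕ) :
    IsWeakDeriv L (toL2 L (dcosFun L k)) (-(freq L k ^ 2) • toL2 L (cosFun L k)) := by
  rw [← map_smul]
  exact isWeakDeriv_toL2 hL (hasDerivAt_dcosFun L k)

/-- The sines vanish at both ends, so `f` needs no boundary condition. This relation between the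
cosine coefficients of `f` and the sine coefficients of its derivative is the source of the spectral
description of `H¹`. -/
theorem IsWeakDeriv.inner_dcosFun {L : ℝ} (hL : 0 < L) {f g : L2 L} (h : IsWeakDeriv L f g)
    (k : ℕ) :
    inner ℝ g (toL2 L (dcosFun L k)) = freq L k ^ 2 * inner ℝ f (toL2 L (cosFun L k)) := by
  have := h.inner_of_test_eq_zero (contDiff_dcosFun L k) (hasDerivAt_dcosFun L k)
    (dcosFun_zero L k) (dcosFun_right hL k)
  rw [map_smul, inner_smul_right] at this
  linarith

theorem freq_injective {L : ℝ} (hL : 0 < L) {j k : ℕ} (h : freq L j ^ 2 = freq L k ^ 2) :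
    j = k := by
  have h0 : ∀ k, 0 ≤ freq L k := fun k => by unfold freq; positivity
  have h1 := (sq_eq_sq₀ (h0 j) (h0 k)).1 h
  unfold freq at h1
  have hpi := Real.pi_pos
  field_simp at h1
  exact_mod_cast h1

theorem inner_cosFun_self {L : ℝ} (hL : 0 < L) (k : ℕ) :
    inner ℝ (toL2 L (cosFun L k)) (toL2 L (cosFun L k)) = 1 := by
  rw [inner_toL2_right]
  have e : ∫ x in Ioo 0 L, toL2 L (cosFun L k) x * cosFun L k x
      = ∫ x in (0 : ℝ)..L, cosFun L k x * cosFun L k x := by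
    rw [intervalIntegral.integral_of_le hL.le, integral_Ioc_eq_integral_Ioo]
    refine integral_congr_ae ?_
    filter_upwards [coeFn_toL2 L (cosFun L k)] with x hx
    rw [hx]
  rw [e]
  simp_rw [cosFun_apply]
  by_cases hk : k = 0
  · subst hk
    simp only [cosCoeff, freq, if_true, Nat.cast_zero, zero_mul, zero_div, Real.cos_zero, mul_one]
    rw [intervalIntegral.integral_const, Real.mul_self_sqrt (by positivity), smul_eq_mul]
    field_simp
    ring
  · have hf : freq L k ≠ 0 := by
      unfold freq
      have := Real.pi_pos
      positivity
    have hd : ∀ x ∈ uIcc 0 L, HasDerivAt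
        (fun x => cosCoeff L k ^ 2 * (x / 2 + Real.sin (2 * freq L k * x) / (4 * freq L k)))
        (cosCoeff L k * Real.cos (freq L k * x) * (cosCoeff L k * Real.cos (freq L k * x))) x := by
      intro x _
      have h1 := (((hasDerivAt_id x).const_mul (2 * freq L k)).sin).div_const (4 * freq L k)
      refine ((((hasDerivAt_id x).div_const 2).add h1).const_mul (cosCoeff L k ^ 2)).congr_deriv ?_
      simp only [id]
      rw [mul_assoc 2, Real.cos_two_mul]
      field_simp
      ring
    rw [intervalIntegral.integral_eq_sub_of_hasDerivAt hd
      (Continuous.intervalIntegrable (by fun_prop) _ _)]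
    have h2 : Real.sin (2 * freq L k * L) = 0 := by
      have : 2 * freq L k * L = (2 * k : ℕ) * Real.pi := by
        unfold freq; push_cast; field_simp
      rw [this, Real.sin_nat_mul_pi]
    rw [h2, cosCoeff, if_neg hk, Real.sq_sqrt (by positivity)]
    simp only [mul_zero, Real.sin_zero, zero_div, add_zero, sub_zero]
    field_simp

/-- Orthogonality needs no trigonometric integral: `⟨e_j', e_k'⟩` equals both `freq L k ^ 2` and
`freq L j ^ 2` times `⟨e_j, e_k⟩`, and the frequencies are distinct. -/
theorem orthonormal_cosFun {L : ℝ} (hL : 0 < L) :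
    Orthonormal ℝ fun k => toL2 L (cosFun L k) := by
  refine ⟨fun k => ?_, fun j k hjk => ?_⟩
  · have := inner_cosFun_self hL k
    rw [real_inner_self_eq_norm_sq] at this
    exact (pow_eq_one_iff_of_nonneg (norm_nonneg _) two_ne_zero).1 this
  · have h1 := (isWeakDeriv_cosFun hL j).inner_dcosFun hL k
    have h2 := (isWeakDeriv_cosFun hL k).inner_dcosFun hL j
    rw [real_inner_comm, h1, real_inner_comm (toL2 L (cosFun L j)), ← sub_eq_zero, ← sub_mul,
      mul_eq_zero] at h2
    refine h2.resolve_left fun h => hjk ?_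
    exact (freq_injective hL (sub_eq_zero.1 h)).symm

theorem rawCos_one_mul (L : ℝ) (k : ℕ) :
    rawCos L 1 * rawCos L (k + 1) = (1 / 2 : ℝ) • (rawCos L (k + 2) + rawCos L k) := by
  ext x
  simp only [BoundedContinuousFunction.mul_apply, BoundedContinuousFunction.smul_apply,
    BoundedContinuousFunction.add_apply, rawCos_apply, smul_eq_mul]
  have e1 : freq L (k + 2) * x = freq L (k + 1) * x + freq L 1 * x := by
    unfold freq; push_cast; ring
  have e2 : freq L k * x = freq L (k + 1) * x - freq L 1 * x := by
    unfold freq; push_cast; ring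
  rw [e1, e2, Real.cos_add, Real.cos_sub]
  ring

theorem rawCos_zero (L : ℝ) : rawCos L 0 = 1 := by
  ext x
  simp [rawCos_apply, freq]

theorem toL2_rawCos_mem_span {L : ℝ} (hL : 0 < L) (k : ℕ) :
    toL2 L (rawCos L k) ∈ Submodule.span ℝ (range fun k => toL2 L (cosFun L k)) := by
  have : rawCos L k = (cosCoeff L k)⁻¹ • cosFun L k := by
    rw [cosFun, smul_smul, inv_mul_cancel₀ (cosCoeff_pos hL k).ne', one_smul]
  rw [this, map_smul]
  exact Submodule.smul_mem _ _ (Submodule.subset_span ⟨k, rfl⟩)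

/-- The product formula moves one factor `rawCos L 1` into the second factor, shifting its index up
and down. The index `k` must therefore vary in the induction. -/
theorem toL2_rawCos_pow_mem_span {L : ℝ} (hL : 0 < L) (n k : ℕ) :
    toL2 L (rawCos L 1 ^ n * rawCos L k) ∈
      Submodule.span ℝ (range fun k => toL2 L (cosFun L k)) := by
  induction n generalizing k with
  | zero => simpa using toL2_rawCos_mem_span hL k
  | succ n ih =>
    rcases k with _ | k
    · rw [rawCos_zero, mul_one, pow_succ]
      exact ih 1
    · rw [pow_succ, mul_assoc, rawCos_one_mul, mul_smul_comm, mul_add, map_smul, map_add]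
      exact Submodule.smul_mem _ _ (Submodule.add_mem _ (ih _) (ih _))

theorem span_cosFun_dense {L : ℝ} (hL : 0 < L) :
    ⊤ ≤ (Submodule.span ℝ (range fun k => toL2 L (cosFun L k))).topologicalClosure := by
  set S := Submodule.span ℝ (range fun k => toL2 L (cosFun L k)) with hS
  have key : ∀ φ : BoundedContinuousFunction ℝ ℝ, toL2 L φ ∈ S.topologicalClosure := by
    intro φ
    rw [← SetLike.mem_coe, Submodule.topologicalClosure_coe, Metric.mem_closure_iff]
    intro ε hε
    set m : ℝ := (measureUnivNNReal (volume.restrict (Ioo (0 : ℝ) L)) : ℝ) ^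
      (ENNReal.toReal 2)⁻¹
    have hm0 : 0 ≤ m := by positivity
    -- Weierstrass approximation in the variable `y = cos (πx/L)`: on `(0, L)` one has `x = (L/π)
    -- arccos y`. The tolerance allows for the factor `m`, the square root of the measure of the
    -- interval, between sup norm and `L²` norm.
    obtain ⟨P, hP⟩ := exists_polynomial_near_of_continuousOn (-1) 1
      (fun y => φ (L / Real.pi * Real.arccos y))
      (φ.continuous.comp (continuous_const.mul Real.continuous_arccos)).continuousOn
      (ε / (m + 1)) (by positivity)
    let q : BoundedContinuousFunction ℝ ℝ :=
      ∑ i ∈ Finset.range (P.natDegree + 1), P.coeff i • rawCos L 1 ^ i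
    have hq : ∀ x, q x = P.eval (Real.cos (freq L 1 * x)) := fun x => by
      rw [Polynomial.eval_eq_sum_range]
      simp only [q, BoundedContinuousFunction.coe_sum, Finset.sum_apply,
        BoundedContinuousFunction.smul_apply, BoundedContinuousFunction.pow_apply, rawCos_apply,
        smul_eq_mul]
    refine ⟨toL2 L q, ?_, ?_⟩
    · simp only [q, map_sum, map_smul]
      refine S.sum_mem fun i _ => S.smul_mem _ ?_
      have := toL2_rawCos_pow_mem_span hL i 0
      rwa [rawCos_zero, mul_one] at this
    · rw [dist_eq_norm, ← map_sub]
      have hb : ∀ᵐ x ∂volume.restrict (Ioo 0 L), ‖toL2 L (φ - q) x‖ ≤ ε / (m + 1) := by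
        filter_upwards [coeFn_toL2 L (φ - q), ae_restrict_mem measurableSet_Ioo] with x hx hxm
        rw [hx, BoundedContinuousFunction.sub_apply, hq]
        have h1 := hP (Real.cos (freq L 1 * x)) ⟨Real.neg_one_le_cos _, Real.cos_le_one _⟩
        have hpi := Real.pi_pos
        have hf1 : freq L 1 * x = Real.pi * (x / L) := by unfold freq; push_cast; ring
        have hx0 : 0 ≤ x / L := div_nonneg hxm.1.le hL.le
        have hx1 : x / L ≤ 1 := (div_le_one hL).2 hxm.2.le
        rw [Real.arccos_cos (by rw [hf1]; positivity)
          (by rw [hf1]; exact mul_le_of_le_one_right hpi.le hx1)] at h1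
        have h2 : L / Real.pi * (freq L 1 * x) = x := by
          rw [hf1]; field_simp
        rw [h2] at h1
        rw [norm_sub_rev]
        exact h1.le
      refine (Lp.norm_le_of_ae_bound (by positivity) hb).trans_lt ?_
      calc m * (ε / (m + 1)) < (m + 1) * (ε / (m + 1)) := by gcongr; linarith
        _ = ε := by field_simp
  intro f _
  have hd := BoundedContinuousFunction.toLp_denseRange (p := 2) ℝ
    (volume.restrict (Ioo (0 : ℝ) L)) ℝ (by norm_num) f
  have hsub : range (BoundedContinuousFunction.toLp 2 (volume.restrict (Ioo (0 : ℝ) L)) ℝ :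
      BoundedContinuousFunction ℝ ℝ →L[ℝ] L2 L) ⊆ (S.topologicalClosure : Set (L2 L)) := by
    rintro _ ⟨φ, rfl⟩
    exact key φ
  exact closure_minimal hsub S.isClosed_topologicalClosure hd

/-- The Hilbert basis of `L²(0, L)` given by the Neumann eigenfunctions. -/
def cosBasis {L : ℝ} (hL : 0 < L) : HilbertBasis ℕ ℝ (L2 L) :=
  HilbertBasis.mk (orthonormal_cosFun hL) (span_cosFun_dense hL)

theorem cosBasis_apply {L : ℝ} (hL : 0 < L) (k : ℕ) : cosBasis hL k = toL2 L (cosFun L k) :=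
  congrFun (HilbertBasis.coe_mk (orthonormal_cosFun hL) (span_cosFun_dense hL)) k

/-! ### Spectral description of `H¹(0, L)` -/

theorem IsWeakDeriv.sum {L : ℝ} {f g : ℕ → L2 L} (h : ∀ k, IsWeakDeriv L (f k) (g k))
    (s : Finset ℕ) : IsWeakDeriv L (∑ k ∈ s, f k) (∑ k ∈ s, g k) := by
  induction s using Finset.cons_induction with
  | empty => simpa using IsWeakDeriv.zero L
  | cons a s ha ih =>
    rw [Finset.sum_cons, Finset.sum_cons]
    exact (h a).add ih

theorem repr_cosBasis {L : ℝ} (hL : 0 < L) (u : L2 L) (k : ℕ) :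
    (cosBasis hL).repr u k = inner ℝ u (toL2 L (cosFun L k)) := by
  rw [HilbertBasis.repr_apply_apply, cosBasis_apply, real_inner_comm]

theorem hasSum_repr_cosBasis {L : ℝ} (hL : 0 < L) (u : L2 L) :
    HasSum (fun k => (cosBasis hL).repr u k • toL2 L (cosFun L k)) u := by
  have := (cosBasis hL).hasSum_repr u
  simpa only [cosBasis_apply] using this

theorem inner_dcosFun_dcosFun {L : ℝ} (hL : 0 < L) (j k : ℕ) :
    inner ℝ (toL2 L (dcosFun L j)) (toL2 L (dcosFun L k)) = if j = k then freq L k ^ 2 else 0 := by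
  rw [(isWeakDeriv_cosFun hL j).inner_dcosFun hL k,
    orthonormal_iff_ite.1 (orthonormal_cosFun hL) j k]
  simp

theorem norm_sum_smul_dcosFun_sq {L : ℝ} (hL : 0 < L) (a : ℕ → ℝ) (s : Finset ℕ) :
    ‖∑ k ∈ s, a k • toL2 L (dcosFun L k)‖ ^ 2 = ∑ k ∈ s, freq L k ^ 2 * a k ^ 2 := by
  rw [← real_inner_self_eq_norm_sq, sum_inner]
  refine Finset.sum_congr rfl fun j hj => ?_
  rw [inner_sum]
  simp only [inner_smul_left, inner_smul_right, inner_dcosFun_dcosFun hL]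
  simp [hj]
  ring

theorem summable_smul_dcosFun {L : ℝ} (hL : 0 < L) {a : ℕ → ℝ}
    (ha : Summable fun k => freq L k ^ 2 * a k ^ 2) :
    Summable fun k => a k • toL2 L (dcosFun L k) := by
  rw [summable_iff_vanishing_norm]
  intro ε hε
  obtain ⟨s, hs⟩ := summable_iff_vanishing_norm.1 ha (ε ^ 2) (by positivity)
  refine ⟨s, fun t ht => ?_⟩
  have h := hs t ht
  rw [← norm_sum_smul_dcosFun_sq hL, norm_pow, norm_norm] at h
  exact lt_of_pow_lt_pow_left₀ 2 hε.le h

/-- Bessel's inequality: a partial sum `S` of the differentiated series satisfies `⟨p, S⟩ = ‖S‖²`,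
so `0 ≤ ‖p - S‖²` yields `‖S‖² ≤ ‖p‖²`. -/
theorem IsWeakDeriv.summable_freq {L : ℝ} (hL : 0 < L) {u p : L2 L} (h : IsWeakDeriv L u p) :
    Summable fun k => freq L k ^ 2 * (cosBasis hL).repr u k ^ 2 := by
  refine summable_of_sum_le (c := ‖p‖ ^ 2) (fun k => by positivity) fun s => ?_
  have h1 : inner ℝ p (∑ k ∈ s, (cosBasis hL).repr u k • toL2 L (dcosFun L k))
      = ∑ k ∈ s, freq L k ^ 2 * (cosBasis hL).repr u k ^ 2 := by
    rw [inner_sum]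
    refine Finset.sum_congr rfl fun k _ => ?_
    rw [inner_smul_right, h.inner_dcosFun hL, ← repr_cosBasis hL]
    ring
  have h2 := norm_sub_sq_real p (∑ k ∈ s, (cosBasis hL).repr u k • toL2 L (dcosFun L k))
  rw [h1, norm_sum_smul_dcosFun_sq hL] at h2
  nlinarith [sq_nonneg ‖p - ∑ k ∈ s, (cosBasis hL).repr u k • toL2 L (dcosFun L k)‖]

theorem isWeakDeriv_tsum {L : ℝ} (hL : 0 < L) {u : L2 L}
    (hu : Summable fun k => freq L k ^ 2 * (cosBasis hL).repr u k ^ 2) :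
    IsWeakDeriv L u (∑' k, (cosBasis hL).repr u k • toL2 L (dcosFun L k)) :=
  IsWeakDeriv.of_tendsto
    (fun N => IsWeakDeriv.sum (fun k => (isWeakDeriv_cosFun hL k).smul ((cosBasis hL).repr u k))
      (Finset.range N))
    (hasSum_repr_cosBasis hL u).tendsto_sum_nat
    (summable_smul_dcosFun hL hu).hasSum.tendsto_sum_nat

/-- The differentiated series converges to a weak derivative because differentiation is closed, and
weak derivatives are unique. So the cosine series of any `H¹` function may be differentiated
termwise, without boundary conditions. -/
theorem IsWeakDeriv.hasSum {L : ℝ} (hL : 0 < L) {u p : L2 L} (h : IsWeakDeriv L u p) :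
    HasSum (fun k => (cosBasis hL).repr u k • toL2 L (dcosFun L k)) p := by
  have hs := h.summable_freq hL
  rw [h.unique (isWeakDeriv_tsum hL hs)]
  exact (summable_smul_dcosFun hL hs).hasSum

theorem IsWeakDeriv.hasSum_norm_sq {L : ℝ} (hL : 0 < L) {u p : L2 L} (h : IsWeakDeriv L u p) :
    HasSum (fun k => freq L k ^ 2 * (cosBasis hL).repr u k ^ 2) (‖p‖ ^ 2) := by
  have h1 := (h.hasSum hL).mapL (innerSL ℝ p)
  rw [innerSL_apply_apply, real_inner_self_eq_norm_sq] at h1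
  refine h1.congr_fun fun k => ?_
  rw [innerSL_apply_apply, inner_smul_right, h.inner_dcosFun hL, ← repr_cosBasis hL]
  ring

theorem weakDeriv_eq {L : ℝ} {φ : H1 L} {p : L2 L} (h : IsWeakDeriv L φ p) : weakDeriv φ = p :=
  (weakDeriv_spec φ).unique h

theorem weakDeriv_add {L : ℝ} (φ ψ : H1 L) : weakDeriv (φ + ψ) = weakDeriv φ + weakDeriv ψ :=
  weakDeriv_eq ((weakDeriv_spec φ).add (weakDeriv_spec ψ))

theorem weakDeriv_smul {L : ℝ} (a : ℝ) (φ : H1 L) : weakDeriv (a • φ) = a • weakDeriv φ :=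
  weakDeriv_eq ((weakDeriv_spec φ).smul a)

theorem weakDeriv_sub {L : ℝ} (φ ψ : H1 L) : weakDeriv (φ - ψ) = weakDeriv φ - weakDeriv ψ := by
  have := weakDeriv_add φ ((-1 : ℝ) • ψ)
  rw [weakDeriv_smul] at this
  simpa [sub_eq_add_neg] using this

/-- Integration by parts against `H¹` functions under Neumann boundary conditions. -/
theorem IsWeakDeriv.inner_eq_of_neumann {L : ℝ} (hL : 0 < L) {p q : L2 L} (h : IsWeakDeriv L p q)
    (hv : VanishesAtEndpoints L p) (φ : H1 L) :
    inner ℝ q (φ : L2 L) = -inner ℝ p (weakDeriv φ) := by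
  -- Both sides are expanded along the cosine series of `φ` and its termwise derivative. The terms
  -- agree because each cosine is a smooth test function and `p` vanishes at the ends.
  have h1 := (hasSum_repr_cosBasis hL (φ : L2 L)).mapL (innerSL ℝ q)
  have h2 := (((weakDeriv_spec φ).hasSum hL).mapL (innerSL ℝ p)).neg
  refine h1.unique (h2.congr_fun fun k => ?_)
  rw [innerSL_apply_apply, innerSL_apply_apply, inner_smul_right, inner_smul_right,
    h.inner_of_vanishesAtEndpoints hL hv (contDiff_cosFun L k) (hasDerivAt_cosFun L k)]
  ring

/-! ### Coordinates of `H¹(0, L)` -/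

/-- The eigenvalues of `1 - ν ∂ₓₓ` with Neumann boundary conditions. -/
def eigval (ν L : ℝ) (k : ℕ) : ℝ := 1 + ν * freq L k ^ 2

theorem one_le_eigval {ν : ℝ} (hν : 0 < ν) (L : ℝ) (k : ℕ) : 1 ≤ eigval ν L k :=
  le_add_of_nonneg_right (by positivity)

theorem eigval_pos {ν : ℝ} (hν : 0 < ν) (L : ℝ) (k : ℕ) : 0 < eigval ν L k :=
  zero_lt_one.trans_le (one_le_eigval hν L k)

theorem memℓp_div_sqrt_eigval {ν : ℝ} (hν : 0 < ν) (L : ℝ) (w : SqSum) :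
    Memℓp (E := fun _ => ℝ) (fun k => w k / √(eigval ν L k)) 2 := by
  rw [memℓp_two_iff]
  refine w.hasSum_sq.summable.of_nonneg_of_le (fun k => sq_nonneg _) fun k => ?_
  rw [div_pow, Real.sq_sqrt (eigval_pos hν L k).le]
  exact div_le_self (sq_nonneg _) (one_le_eigval hν L k)

/-- The operator `(1 - ν ∂ₓₓ)^{-1/2}` in coordinates. -/
def divSqrtEigval {ν : ℝ} (hν : 0 < ν) (L : ℝ) : SqSum →ₗ[ℝ] SqSum where
  toFun w := ⟨fun k => w k / √(eigval ν L k), memℓp_div_sqrt_eigval hν L w⟩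
  map_add' v w := by
    ext k
    exact add_div (v k) (w k) _
  map_smul' a w := by
    ext k
    exact mul_div_assoc a (w k) _

theorem divSqrtEigval_apply {ν : ℝ} (hν : 0 < ν) (L : ℝ) (w : SqSum) (k : ℕ) :
    divSqrtEigval hν L w k = w k / √(eigval ν L k) := rfl

theorem summable_freq_divSqrtEigval {ν : ℝ} (hν : 0 < ν) (L : ℝ) (w : SqSum) :
    Summable fun k => freq L k ^ 2 * divSqrtEigval hν L w k ^ 2 := by
  refine (w.hasSum_sq.summable.mul_left (1 / ν)).of_nonneg_of_le (fun k => by positivity)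
    fun k => ?_
  rw [divSqrtEigval_apply, div_pow, Real.sq_sqrt (eigval_pos hν L k).le]
  have h1 := eigval_pos hν L k
  have h2 : ν * freq L k ^ 2 ≤ eigval ν L k := by unfold eigval; linarith
  rw [← mul_div_assoc, div_le_iff₀ h1]
  field_simp
  nlinarith [sq_nonneg (w k)]

/-- The parametrisation of `H¹(0, L)` by its coordinates: the function with the cosine
coefficients `w_k / √λ_k`. -/
def toH1 {ν L : ℝ} (hν : 0 < ν) (hL : 0 < L) : SqSum →ₗ[ℝ] H1 L :=
  LinearMap.codRestrict (H1 L)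
    ((cosBasis hL).repr.symm.toLinearEquiv.toLinearMap ∘ₗ divSqrtEigval hν L) fun w =>
      ⟨_, isWeakDeriv_tsum hL (u := (cosBasis hL).repr.symm (divSqrtEigval hν L w)) (by
        rw [LinearIsometryEquiv.apply_symm_apply]
        exact summable_freq_divSqrtEigval hν L w)⟩

theorem coe_toH1 {ν L : ℝ} (hν : 0 < ν) (hL : 0 < L) (w : SqSum) :
    (toH1 hν hL w : L2 L) = (cosBasis hL).repr.symm (divSqrtEigval hν L w) := rfl

theorem repr_toH1 {ν L : ℝ} (hν : 0 < ν) (hL : 0 < L) (w : SqSum) (k : ℕ) :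
    (cosBasis hL).repr (toH1 hν hL w : L2 L) k = w k / √(eigval ν L k) := by
  rw [coe_toH1, LinearIsometryEquiv.apply_symm_apply, divSqrtEigval_apply]

theorem hasSum_repr_sq {L : ℝ} (hL : 0 < L) (u : L2 L) :
    HasSum (fun k => (cosBasis hL).repr u k ^ 2) (‖u‖ ^ 2) := by
  have := SqSum.hasSum_sq ((cosBasis hL).repr u)
  rwa [LinearIsometryEquiv.norm_map] at this

/-- `λ_k = 1 + ν freq²` splits each `w_k²` into two parts, summed by Parseval for `u` and for `u_x`.
-/
theorem norm_sq_eq_toH1 {ν L : ℝ} (hν : 0 < ν) (hL : 0 < L) (w : SqSum) :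
    ‖w‖ ^ 2 = ‖(toH1 hν hL w : L2 L)‖ ^ 2 + ν * ‖weakDeriv (toH1 hν hL w)‖ ^ 2 := by
  have h1 := (hasSum_repr_sq hL (toH1 hν hL w : L2 L)).add
    (((weakDeriv_spec (toH1 hν hL w)).hasSum_norm_sq hL).mul_left ν)
  refine w.hasSum_sq.unique (h1.congr_fun fun k => ?_)
  rw [repr_toH1, div_pow, Real.sq_sqrt (eigval_pos hν L k).le]
  have := eigval_pos hν L k
  field_simp
  unfold eigval
  ring

theorem exists_toH1_eq {ν L : ℝ} (hν : 0 < ν) (hL : 0 < L) (φ : H1 L) :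
    ∃ w, toH1 hν hL w = φ := by
  have hs := (weakDeriv_spec φ).summable_freq hL
  have hm : Memℓp (E := fun _ => ℝ)
      (fun k => √(eigval ν L k) * (cosBasis hL).repr (φ : L2 L) k) 2 := by
    rw [memℓp_two_iff]
    refine ((hasSum_repr_sq hL (φ : L2 L)).summable.add (hs.mul_left ν)).congr fun k => ?_
    rw [mul_pow, Real.sq_sqrt (eigval_pos hν L k).le, eigval]
    ring
  refine ⟨⟨_, hm⟩, Subtype.ext ((cosBasis hL).repr.injective ?_)⟩
  ext k
  rw [repr_toH1]
  exact mul_div_cancel_left₀ _ (Real.sqrt_pos.2 (eigval_pos hν L k)).ne'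

theorem h1Norm_toH1_sq_le {ν L : ℝ} (hν : 0 < ν) (hL : 0 < L) (w : SqSum) :
    h1Norm (toH1 hν hL w) ^ 2 ≤ (1 / L ^ 2 + 1 / ν) * ‖w‖ ^ 2 := by
  rw [h1Norm, Real.sq_sqrt (by positivity), norm_sq_eq_toH1 hν hL w]
  have h1 : 0 ≤ 1 / L ^ 2 * (ν * ‖weakDeriv (toH1 hν hL w)‖ ^ 2) := by positivity
  have h2 : 0 ≤ 1 / ν * ‖(toH1 hν hL w : L2 L)‖ ^ 2 := by positivity
  have h3 : 1 / ν * (ν * ‖weakDeriv (toH1 hν hL w)‖ ^ 2) = ‖weakDeriv (toH1 hν hL w)‖ ^ 2 := by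
    field_simp
  nlinarith

/-! ### Uniform bounds -/

theorem summable_inv_eigval {ν L : ℝ} (hν : 0 < ν) (hL : 0 < L) :
    Summable fun k => 1 / eigval ν L k := by
  have hpi := Real.pi_pos
  have h := (Real.summable_one_div_nat_pow.2 (one_lt_two)).mul_left (L ^ 2 / (ν * Real.pi ^ 2))
  -- The frequency vanishes at `k = 0`, so the comparison with `1/k²` starts at index `1`.
  rw [← summable_nat_add_iff 1] at h ⊢
  refine h.of_nonneg_of_le (fun k => (div_pos one_pos (eigval_pos hν L _)).le) fun k => ?_
  have : L ^ 2 / (ν * Real.pi ^ 2) * (1 / ((k + 1 : ℕ) : ℝ) ^ 2)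
      = 1 / (ν * freq L (k + 1) ^ 2) := by
    unfold freq; field_simp
  rw [this]
  have hf : 0 < freq L (k + 1) := by unfold freq; positivity
  exact one_div_le_one_div_of_le (by positivity) (by unfold eigval; linarith)

/-- The constant in the embedding of `H¹(0, L)` into the bounded functions. -/
def embeddingConst (ν L : ℝ) : ℝ := √(2 / L) * √(∑' k, 1 / eigval ν L k)

theorem sum_abs_div_sqrt_eigval_le {ν L : ℝ} (hν : 0 < ν) (hL : 0 < L) (w : SqSum)
    (s : Finset ℕ) :
    ∑ k ∈ s, |w k| / √(eigval ν L k) ≤ √(∑' k, 1 / eigval ν L k) * ‖w‖ := by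
  have h1 := Real.sum_mul_le_sqrt_mul_sqrt s (fun k => 1 / √(eigval ν L k)) (fun k => |w k|)
  have h2 : ∑ k ∈ s, (1 / √(eigval ν L k)) ^ 2 ≤ ∑' k, 1 / eigval ν L k := by
    refine le_trans (le_of_eq (Finset.sum_congr rfl fun k _ => ?_))
      ((summable_inv_eigval hν hL).sum_le_tsum s
        fun k _ => (div_pos one_pos (eigval_pos hν L k)).le)
    rw [div_pow, one_pow, Real.sq_sqrt (eigval_pos hν L k).le]
  have h3 : √(∑ k ∈ s, |w k| ^ 2) ≤ ‖w‖ := by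
    refine Real.sqrt_le_iff.2 ⟨norm_nonneg _, ?_⟩
    simp_rw [sq_abs]
    exact w.sum_sq_le s
  calc ∑ k ∈ s, |w k| / √(eigval ν L k) = ∑ k ∈ s, 1 / √(eigval ν L k) * |w k| :=
        Finset.sum_congr rfl fun k _ => by ring
    _ ≤ _ := h1
    _ ≤ _ := by gcongr

theorem summable_abs_div_sqrt_eigval {ν L : ℝ} (hν : 0 < ν) (hL : 0 < L) (w : SqSum) :
    Summable fun k => |w k| / √(eigval ν L k) :=
  summable_of_sum_le (fun k => by positivity) (sum_abs_div_sqrt_eigval_le hν hL w)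

/-- Since `1/√λ_k` is square-summable, Cauchy–Schwarz makes the cosine series of `u` absolutely
convergent in the sup norm. -/
theorem ae_abs_toH1_le {ν L : ℝ} (hν : 0 < ν) (hL : 0 < L) (w : SqSum) :
    ∀ᵐ x ∂volume.restrict (Ioo 0 L), |(toH1 hν hL w : L2 L) x| ≤ embeddingConst ν L * ‖w‖ := by
  have hb : ∀ k, ‖(w k / √(eigval ν L k)) • cosFun L k‖
      ≤ √(2 / L) * (|w k| / √(eigval ν L k)) := fun k => by
    rw [norm_smul, norm_div, Real.norm_eq_abs, Real.norm_of_nonneg (Real.sqrt_nonneg _), mul_comm]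
    gcongr
    exact norm_cosFun_le hL k
  have hs : Summable fun k => ‖(w k / √(eigval ν L k)) • cosFun L k‖ :=
    ((summable_abs_div_sqrt_eigval hν hL w).mul_left _).of_nonneg_of_le
      (fun k => norm_nonneg _) hb
  have hn : ‖∑' k, (w k / √(eigval ν L k)) • cosFun L k‖ ≤ embeddingConst ν L * ‖w‖ := by
    refine (norm_tsum_le_tsum_norm hs).trans ?_
    refine hs.tsum_le_of_sum_le fun s => ?_
    refine (Finset.sum_le_sum fun k _ => hb k).trans ?_
    rw [← Finset.mul_sum, embeddingConst, mul_assoc]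
    exact mul_le_mul_of_nonneg_left (sum_abs_div_sqrt_eigval_le hν hL w s) (Real.sqrt_nonneg _)
  have he : (toH1 hν hL w : L2 L) = toL2 L (∑' k, (w k / √(eigval ν L k)) • cosFun L k) := by
    have h1 := hasSum_repr_cosBasis hL (toH1 hν hL w : L2 L)
    simp_rw [repr_toH1] at h1
    have h2 := hs.of_norm.hasSum.mapL (toL2 L)
    simp_rw [map_smul] at h2
    exact h1.unique h2
  rw [he]
  filter_upwards [coeFn_toL2 L (∑' k, (w k / √(eigval ν L k)) • cosFun L k)] with x hx
  rw [hx]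
  exact (BoundedContinuousFunction.norm_coe_le_norm _ x).trans hn

/-! ### The domain of the Neumann Laplacian -/

/-- The second derivative of `toH1 w` if `z = λ^{1/2} w`. -/
def secondDeriv {ν L : ℝ} (hν : 0 < ν) (hL : 0 < L) (w z : SqSum) : L2 L :=
  (1 / ν) • ((toH1 hν hL w : L2 L) - (cosBasis hL).repr.symm z)

theorem repr_secondDeriv {ν L : ℝ} (hν : 0 < ν) (hL : 0 < L) {w z : SqSum}
    (hz : ∀ k, z k = √(eigval ν L k) * w k) (k : ℕ) :
    (cosBasis hL).repr (secondDeriv hν hL w z) k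
      = -(freq L k ^ 2) * (cosBasis hL).repr (toH1 hν hL w : L2 L) k := by
  rw [secondDeriv, map_smul, map_sub, LinearIsometryEquiv.apply_symm_apply, lp.coeFn_smul,
    Pi.smul_apply, lp.coeFn_sub, Pi.sub_apply, hz, repr_toH1]
  have h0 := Real.sqrt_pos.2 (eigval_pos hν L k)
  have h1 := Real.sq_sqrt (eigval_pos hν L k).le
  rw [smul_eq_mul]
  field_simp
  rw [h1, eigval]
  ring

theorem isWeakDeriv_secondDeriv {ν L : ℝ} (hν : 0 < ν) (hL : 0 < L) {w z : SqSum}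
    (hz : ∀ k, z k = √(eigval ν L k) * w k) :
    IsWeakDeriv L (weakDeriv (toH1 hν hL w)) (secondDeriv hν hL w z) := by
  refine IsWeakDeriv.of_tendsto
    (fun N => IsWeakDeriv.sum (fun k => (isWeakDeriv_dcosFun hL k).smul
      ((cosBasis hL).repr (toH1 hν hL w : L2 L) k)) (Finset.range N))
    ((weakDeriv_spec (toH1 hν hL w)).hasSum hL).tendsto_sum_nat ?_
  have h := hasSum_repr_cosBasis hL (secondDeriv hν hL w z)
  refine (h.congr_fun fun k => ?_).tendsto_sum_nat
  rw [repr_secondDeriv hν hL hz, smul_smul]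
  congr 1
  ring

/-- As `freq ≤ √(λ_k/ν)`, the terms of the sine series of `u_x` are bounded by a constant times
`|w_k| = |z_k|/√λ_k`, which is summable because `z` is in `ℓ²`. The series converges uniformly and
every term vanishes at the ends. -/
theorem vanishesAtEndpoints_weakDeriv {ν L : ℝ} (hν : 0 < ν) (hL : 0 < L) {w z : SqSum}
    (hz : ∀ k, z k = √(eigval ν L k) * w k) :
    VanishesAtEndpoints L (weakDeriv (toH1 hν hL w)) := by
  have hs : Summable fun k => (w k / √(eigval ν L k)) • dcosFun L k := by
    refine Summable.of_norm (((summable_abs_div_sqrt_eigval hν hL z).mul_left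
      (√(2 / L) * (1 / √ν))).of_nonneg_of_le (fun k => norm_nonneg _) fun k => ?_)
    have hf : 0 ≤ freq L k := by unfold freq; positivity
    have h0 := Real.sqrt_pos.2 (eigval_pos hν L k)
    have h1 : freq L k ≤ 1 / √ν * √(eigval ν L k) := by
      rw [one_div_mul_eq_div, le_div_iff₀ (Real.sqrt_pos.2 hν)]
      refine Real.le_sqrt_of_sq_le ?_
      rw [mul_pow, Real.sq_sqrt hν.le, eigval]
      linarith
    rw [norm_smul, norm_div, Real.norm_eq_abs, Real.norm_of_nonneg h0.le, hz, abs_mul,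
      abs_of_pos h0]
    calc |w k| / √(eigval ν L k) * ‖dcosFun L k‖
        ≤ |w k| / √(eigval ν L k) * (√(2 / L) * (1 / √ν * √(eigval ν L k))) := by
          gcongr
          exact (norm_dcosFun_le hL k).trans (by gcongr)
      _ = _ := by field_simp
  have he : weakDeriv (toH1 hν hL w) = toL2 L (∑' k, (w k / √(eigval ν L k)) • dcosFun L k) := by
    have h1 := (weakDeriv_spec (toH1 hν hL w)).hasSum hL
    simp_rw [repr_toH1] at h1
    have h2 := hs.hasSum.mapL (toL2 L)
    simp_rw [map_smul] at h2
    exact h1.unique h2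
  have hev : ∀ x, (∀ k, dcosFun L k x = 0) →
      (∑' k, (w k / √(eigval ν L k)) • dcosFun L k) x = 0 := fun x hx => by
    have h1 := hs.hasSum.mapL (BoundedContinuousFunction.evalCLM ℝ x)
    simp only [map_smul, BoundedContinuousFunction.evalCLM_apply, hx, smul_zero] at h1
    exact h1.unique hasSum_zero
  refine ⟨_, (BoundedContinuousFunction.continuous _).continuousOn,
    he ▸ coeFn_toL2 L (∑' k, (w k / √(eigval ν L k)) • dcosFun L k), hev 0 (dcosFun_zero L),
    hev L (dcosFun_right hL)⟩

/-! ### Exponential decay of absolutely continuous curves -/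

/-- Increments of the norm are bounded by increments of `∫ ‖p‖`, which is absolutely continuous. -/
theorem absolutelyContinuousOnInterval_norm_integral {X : Type*} [NormedAddCommGroup X]
    [NormedSpace ℝ X] (x₀ : X) {p : ℝ → X} {T : ℝ} (hp : IntervalIntegrable p volume 0 T) :
    AbsolutelyContinuousOnInterval (fun t => ‖x₀ + ∫ s in (0 : ℝ)..t, p s‖) 0 T := by
  have hF := hp.norm.absolutelyContinuousOnInterval_intervalIntegral (c := 0) left_mem_uIcc
  rw [absolutelyContinuousOnInterval_iff] at hF ⊢
  intro ε hε
  obtain ⟨δ, hδ, h⟩ := hF ε hε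
  refine ⟨δ, hδ, fun E hE hs => (Finset.sum_le_sum fun i hi => ?_).trans_lt (h E hE hs)⟩
  have hi' := hE.1 i hi
  have hsub : ∀ {a}, a ∈ uIcc 0 T → IntervalIntegrable p volume 0 a := fun ha =>
    hp.mono_set (uIcc_subset_uIcc_left ha)
  rw [Real.dist_eq, Real.dist_eq]
  refine (abs_norm_sub_norm_le _ _).trans ?_
  rw [add_sub_add_left_eq_sub,
    intervalIntegral.integral_interval_sub_left (hsub hi'.1) (hsub hi'.2),
    intervalIntegral.integral_interval_sub_left (hsub hi'.1).norm (hsub hi'.2).norm]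
  exact intervalIntegral.norm_integral_le_abs_integral_norm

/-- `e^{rt} ‖x‖²` is absolutely continuous, so a sign of its derivative almost everywhere is enough
to compare the values at `T` and `0`. -/
theorem norm_sq_le_exp_of_inner_le {X : Type*} [NormedAddCommGroup X] [InnerProductSpace ℝ X]
    [CompleteSpace X] {r T : ℝ} (hT : 0 ≤ T) {x p : ℝ → X}
    (hp : IntervalIntegrable p volume 0 T)
    (hx : ∀ t, 0 ≤ t → x t = x 0 + ∫ s in (0 : ℝ)..t, p s)
    (h : ∀ᵐ t ∂volume.restrict (Ioi (0 : ℝ)), inner ℝ (x t) (p t) ≤ -(r / 2) * ‖x t‖ ^ 2) :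
    ‖x T‖ ^ 2 ≤ Real.exp (-r * T) * ‖x 0‖ ^ 2 := by
  set W : ℝ → X := fun t => x 0 + ∫ s in (0 : ℝ)..t, p s with hW
  have hN := absolutelyContinuousOnInterval_norm_integral (x 0) hp
  have hexp : AbsolutelyContinuousOnInterval (fun t => Real.exp (r * t)) 0 T :=
    ContDiffOn.absolutelyContinuousOnInterval
      ((by fun_prop : ContDiff ℝ 1 fun t => Real.exp (r * t)).contDiffOn)
  have hy := hexp.fun_mul (hN.fun_mul hN)
  have hint := hy.integral_deriv_eq_sub
  have hle : ∫ t in (0 : ℝ)..T,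
      deriv (fun t => Real.exp (r * t) * (‖W t‖ * ‖W t‖)) t ≤ 0 := by
    rw [intervalIntegral.integral_of_le hT]
    refine integral_nonpos_of_ae ?_
    rw [EventuallyLE, ae_restrict_iff' measurableSet_Ioc]
    rw [ae_restrict_iff' measurableSet_Ioi] at h
    filter_upwards [h, hp.ae_hasDerivAt_integral] with t ht hd htm
    have htm' : t ∈ uIcc 0 T := by rw [uIcc_of_le hT]; exact Ioc_subset_Icc_self htm
    have h1 : HasDerivAt W (p t) t := (hd htm' 0 left_mem_uIcc).const_add (x 0)
    have h2 : HasDerivAt (fun t => Real.exp (r * t)) (Real.exp (r * t) * r) t := by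
      simpa using ((hasDerivAt_id t).const_mul r).exp
    have h3 := h2.mul h1.norm_sq
    have h4 : (fun t => Real.exp (r * t) * (‖W t‖ * ‖W t‖))
        = (fun t => Real.exp (r * t)) * (fun t => ‖W t‖ ^ 2) := by
      funext t
      simp [sq]
    rw [h4, h3.deriv]
    have h5 := ht htm.1
    rw [hx t htm.1.le] at h5
    have h6 : Real.exp (r * t) * r * ‖W t‖ ^ 2 + Real.exp (r * t) * (2 * inner ℝ (W t) (p t))
        = Real.exp (r * t) * (r * ‖W t‖ ^ 2 + 2 * inner ℝ (W t) (p t)) := by ring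
    simp only [Pi.zero_apply]
    rw [h6]
    refine mul_nonpos_of_nonneg_of_nonpos (Real.exp_pos _).le ?_
    simp only [hW]
    linarith
  have hT' : W T = x T := (hx T hT).symm
  have h0 : W 0 = x 0 := by simp [hW]
  change _ = Real.exp (r * T) * (‖W T‖ * ‖W T‖) - Real.exp (r * 0) * (‖W 0‖ * ‖W 0‖) at hint
  have hle' := hint.symm.trans_le hle
  rw [hT', h0] at hle'
  simp only [mul_zero, Real.exp_zero, one_mul] at hle'
  have h7 : Real.exp (-r * T) * Real.exp (r * T) = 1 := by rw [← Real.exp_add]; simp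
  have h8 := mul_le_mul_of_nonneg_left hle' (Real.exp_pos (-r * T)).le
  calc ‖x T‖ ^ 2 = Real.exp (-r * T) * Real.exp (r * T) * ‖x T‖ ^ 2 := by rw [h7, one_mul]
    _ ≤ _ := by linarith

/-! ### The dissipation estimate -/

/-- The feedback dominates the linear instability. -/
theorem dissipation {L ν α μ c h : ℝ} (hμ : 0 < μ) {I : H1 L →ₗ[ℝ] L2 L}
    (hI : ∀ φ : H1 L, ‖(φ : L2 L) - I φ‖ ≤ c * h * h1Norm φ) (hνμ : μ * c ^ 2 * h ^ 2 ≤ ν)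
    (φ : H1 L) :
    -ν * ‖weakDeriv φ‖ ^ 2 + α * ‖(φ : L2 L)‖ ^ 2 - μ * inner ℝ (φ : L2 L) (I φ)
      ≤ -((μ - (2 * α + ν / L ^ 2)) / 2) * ‖(φ : L2 L)‖ ^ 2 - ν / 2 * ‖weakDeriv φ‖ ^ 2 := by
  have h1 : ‖(φ : L2 L) - I φ‖ ^ 2 ≤ (c * h * h1Norm φ) ^ 2 :=
    pow_le_pow_left₀ (norm_nonneg _) (hI φ) 2
  have h2 : h1Norm φ ^ 2 = 1 / L ^ 2 * ‖(φ : L2 L)‖ ^ 2 + ‖weakDeriv φ‖ ^ 2 := by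
    rw [h1Norm, Real.sq_sqrt (by positivity)]
  have h3 : μ * ‖(φ : L2 L) - I φ‖ ^ 2 ≤ ν * h1Norm φ ^ 2 := by
    calc μ * ‖(φ : L2 L) - I φ‖ ^ 2 ≤ μ * (c * h * h1Norm φ) ^ 2 := by gcongr
      _ = μ * c ^ 2 * h ^ 2 * h1Norm φ ^ 2 := by ring
      _ ≤ ν * h1Norm φ ^ 2 := by gcongr
  rw [h2] at h3
  have h4 : inner ℝ (φ : L2 L) (I φ)
      = ‖(φ : L2 L)‖ ^ 2 - inner ℝ (φ : L2 L) ((φ : L2 L) - I φ) := by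
    rw [inner_sub_right, real_inner_self_eq_norm_sq]; ring
  have h5 := real_inner_le_norm (φ : L2 L) ((φ : L2 L) - I φ)
  have h6 : inner ℝ (φ : L2 L) ((φ : L2 L) - I φ)
      ≤ (‖(φ : L2 L)‖ ^ 2 + ‖(φ : L2 L) - I φ‖ ^ 2) / 2 := by
    nlinarith [sq_nonneg (‖(φ : L2 L)‖ - ‖(φ : L2 L) - I φ‖)]
  have h7 := mul_le_mul_of_nonneg_left h6 hμ.le
  rw [h4]
  have h8 : ν * (1 / L ^ 2 * ‖(φ : L2 L)‖ ^ 2) = ν / L ^ 2 * ‖(φ : L2 L)‖ ^ 2 := by ring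
  linarith

theorem VanishesAtEndpoints.sub {L : ℝ} {f g : L2 L} (hf : VanishesAtEndpoints L f)
    (hg : VanishesAtEndpoints L g) : VanishesAtEndpoints L (f - g) := by
  obtain ⟨F, hFc, hF, hF0, hFL⟩ := hf
  obtain ⟨G, hGc, hG, hG0, hGL⟩ := hg
  refine ⟨fun x => F x - G x, hFc.sub hGc, ?_, by simp [hF0, hG0], by simp [hFL, hGL]⟩
  filter_upwards [Lp.coeFn_sub f g, hF, hG] with x h1 h2 h3
  rw [h1, Pi.sub_apply, h2, h3]

theorem IsWeakDeriv.sub {L : ℝ} {f₁ f₂ g₁ g₂ : L2 L} (h₁ : IsWeakDeriv L f₁ g₁)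
    (h₂ : IsWeakDeriv L f₂ g₂) : IsWeakDeriv L (f₁ - f₂) (g₁ - g₂) := by
  have := h₁.add (h₂.smul (-1))
  simpa [sub_eq_add_neg] using this

theorem cube_sub_mul_nonneg (a b : ℝ) : 0 ≤ (a - b) * (a ^ 3 - b ^ 3) := by
  have h : (a - b) * (a ^ 3 - b ^ 3) = (a - b) ^ 2 * ((a + b) ^ 2 + a ^ 2 + b ^ 2) / 2 := by ring
  rw [h]
  positivity

theorem intervalIntegrable_of_memLp_two {X : Type*} [NormedAddCommGroup X] {p : ℝ → X} {T : ℝ}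
    (hT : 0 ≤ T) (h : MemLp p 2 (volume.restrict (Ioo 0 T))) : IntervalIntegrable p volume 0 T :=
  (intervalIntegrable_iff_integrableOn_Ioo_of_le hT).2 (h.integrable (by norm_num))

/-- Two global solutions approach each other exponentially in `L²`. -/
theorem IsGlobalSolution.norm_sub_sq_le {L ν α μ c h : ℝ} (hL : 0 < L) (hν : 0 < ν) (hμ : 0 < μ)
    {I : H1 L →ₗ[ℝ] L2 L} (hI : ∀ φ : H1 L, ‖(φ : L2 L) - I φ‖ ≤ c * h * h1Norm φ)
    (hνμ : μ * c ^ 2 * h ^ 2 ≤ ν) {u₀ v₀ : H1 L} {u v : ℝ → H1 L}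
    (hu : IsGlobalSolution L ν α μ I u₀ u) (hv : IsGlobalSolution L ν α μ I v₀ v) {t : ℝ}
    (ht : 0 ≤ t) :
    ‖(u t : L2 L) - v t‖ ^ 2
      ≤ Real.exp (-(μ - (2 * α + ν / L ^ 2)) * t) * ‖(u₀ : L2 L) - v₀‖ ^ 2 := by
  obtain ⟨ut, uxx, hut, -, hu1, hu2⟩ := hu.equation
  obtain ⟨vt, vxx, hvt, -, hv1, hv2⟩ := hv.equation
  -- Square-integrability is given only for positive times; passing through `T + 1` includes `T =
  -- 0`.
  have hii : ∀ {T}, 0 ≤ T → IntervalIntegrable ut volume 0 T := fun {T} hT =>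
    (intervalIntegrable_of_memLp_two (by linarith) (hut (T + 1) (by linarith))).mono_set
      (uIcc_subset_uIcc_left (by rw [uIcc_of_le (by linarith)]; exact ⟨hT, by linarith⟩))
  have hij : ∀ {T}, 0 ≤ T → IntervalIntegrable vt volume 0 T := fun {T} hT =>
    (intervalIntegrable_of_memLp_two (by linarith) (hvt (T + 1) (by linarith))).mono_set
      (uIcc_subset_uIcc_left (by rw [uIcc_of_le (by linarith)]; exact ⟨hT, by linarith⟩))
  have key := norm_sq_le_exp_of_inner_le (r := μ - (2 * α + ν / L ^ 2)) ht
    (x := fun t => (u t : L2 L) - v t) (p := fun t => ut t - vt t) ((hii ht).sub (hij ht)) ?_ ?_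
  · simpa only [hu.initial, hv.initial] using key
  · intro s hs
    rw [intervalIntegral.integral_sub (hii hs) (hij hs), hu1 s hs, hv1 s hs]
    abel
  · filter_upwards [hu2, hv2] with s ⟨hw, hz, he⟩ ⟨hw', hz', he'⟩
    have hwd : IsWeakDeriv L (weakDeriv (u s - v s)) (uxx s - vxx s) := by
      rw [weakDeriv_sub]; exact hw.sub hw'
    have hvan : VanishesAtEndpoints L (weakDeriv (u s - v s)) := by
      rw [weakDeriv_sub]; exact hz.sub hz'
    have hibp := hwd.inner_eq_of_neumann hL hvan (u s - v s)
    rw [real_inner_self_eq_norm_sq, real_inner_comm] at hibp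
    set d : L2 L := ((u s - v s : H1 L) : L2 L) with hd
    have hd' : (u s : L2 L) - v s = d := rfl
    set Y : L2 L := ν • (uxx s - vxx s) + α • d - μ • I (u s - v s) with hY
    -- By the two equations `Y - (ut s - vt s)` equals `u³ - v³` almost everywhere. Working with
    -- this `L²` element avoids any integrability question for the separate cubes.
    have hnn : 0 ≤ inner ℝ d (Y - (ut s - vt s)) := by
      rw [inner_eq_integral]
      refine integral_nonneg_of_ae ?_
      filter_upwards [he, he', Lp.coeFn_sub Y (ut s - vt s), Lp.coeFn_sub (ut s) (vt s),
        Lp.coeFn_sub (uxx s) (vxx s), Lp.coeFn_sub (u s : L2 L) (v s),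
        Lp.coeFn_sub (I (u s)) (I (v s)), Lp.coeFn_smul ν (uxx s - vxx s), Lp.coeFn_smul α d,
        Lp.coeFn_smul μ (I (u s - v s)), Lp.coeFn_add (ν • (uxx s - vxx s)) (α • d),
        Lp.coeFn_sub (ν • (uxx s - vxx s) + α • d) (μ • I (u s - v s))]
        with x e1 e2 c1 c2 c3 c4 c5 c6 c7 c8 c9 c10
      rw [← map_sub] at c5
      rw [← hY] at c10
      rw [hd'] at c4
      simp only [Pi.zero_apply, Pi.sub_apply, Pi.add_apply, Pi.smul_apply, smul_eq_mul] at *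
      rw [c1, c10, c9, c8, c7, c6, c5, c4, c3, c2]
      have := cube_sub_mul_nonneg ((u s : L2 L) x) ((v s : L2 L) x)
      have e : ν * (uxx s x - vxx s x) + α * ((u s : L2 L) x - (v s : L2 L) x)
          - μ * (I (u s) x - I (v s) x) - (ut s x - vt s x)
          = (u s : L2 L) x ^ 3 - (v s : L2 L) x ^ 3 := by linarith
      rw [e]
      exact this
    have hdis := dissipation (α := α) hμ hI hνμ (u s - v s)
    rw [← hd] at hdis
    rw [inner_sub_right, hY, inner_sub_right, inner_add_right, inner_smul_right, inner_smul_right,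
      inner_smul_right, hibp, real_inner_self_eq_norm_sq] at hnn
    simp only [hd']
    have hnu : 0 ≤ ν / 2 * ‖weakDeriv (u s - v s)‖ ^ 2 := by positivity
    linarith

/-! ### The truncated cubic -/

/-- A monotone, globally Lipschitz function which agrees with `s ↦ s ^ 3` on `[-R, R]`. -/
def truncCube (R s : ℝ) : ℝ := ∫ r in (0 : ℝ)..s, 3 * min (r ^ 2) (R ^ 2)

theorem truncCube_zero (R : ℝ) : truncCube R 0 = 0 := by simp [truncCube]

theorem hasDerivAt_truncCube (R s : ℝ) :
    HasDerivAt (truncCube R) (3 * min (s ^ 2) (R ^ 2)) s :=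
  hasDerivAt_integral_of_continuous (φ := fun r => 3 * min (r ^ 2) (R ^ 2)) (by fun_prop) s

theorem lipschitzWith_truncCube (R : ℝ) :
    LipschitzWith (Real.toNNReal (3 * R ^ 2)) (truncCube R) := by
  refine lipschitzWith_of_nnnorm_deriv_le (fun s => (hasDerivAt_truncCube R s).differentiableAt)
    fun s => ?_
  rw [(hasDerivAt_truncCube R s).deriv, ← NNReal.coe_le_coe, coe_nnnorm,
    Real.coe_toNNReal _ (by positivity), Real.norm_of_nonneg (by positivity)]
  gcongr
  exact min_le_right _ _

theorem truncCube_eq {R s : ℝ} (h : |s| ≤ R) : truncCube R s = s ^ 3 := by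
  have h1 : ∀ r ∈ uIcc 0 s, 3 * min (r ^ 2) (R ^ 2) = 3 * r ^ 2 := fun r hr => by
    have hr' : |r| ≤ |s| := by
      have := abs_sub_left_of_mem_uIcc hr
      simpa using this
    rw [min_eq_left (sq_le_sq' ?_ ?_)]
    · linarith [neg_abs_le r]
    · linarith [le_abs_self r]
  rw [truncCube, intervalIntegral.integral_congr h1, intervalIntegral.integral_const_mul,
    integral_pow]
  push_cast
  ring

/-- `g(u)` for the truncated cubic `g` and `u ∈ L²(0, L)`. -/
def truncCubeL2 (L R : ℝ) (u : L2 L) : L2 L :=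
  (lipschitzWith_truncCube R).compLp (truncCube_zero R) u

theorem coeFn_truncCubeL2 (L R : ℝ) (u : L2 L) :
    truncCubeL2 L R u =ᵐ[volume.restrict (Ioo 0 L)] fun x => truncCube R (u x) :=
  (lipschitzWith_truncCube R).coeFn_compLp (truncCube_zero R) u

theorem lipschitzWith_truncCubeL2 (L R : ℝ) :
    LipschitzWith (Real.toNNReal (3 * R ^ 2)) (truncCubeL2 L R) :=
  (lipschitzWith_truncCube R).lipschitzWith_compLp (truncCube_zero R)

theorem truncCube_mul_self_nonneg (R s : ℝ) : 0 ≤ s * truncCube R s := by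
  have hm : Monotone (truncCube R) := monotone_of_deriv_nonneg
    (fun s => (hasDerivAt_truncCube R s).differentiableAt)
    fun s => by rw [(hasDerivAt_truncCube R s).deriv]; positivity
  rcases le_total 0 s with hs | hs
  · have := hm hs
    rw [truncCube_zero] at this
    exact mul_nonneg hs this
  · have := hm hs
    rw [truncCube_zero] at this
    exact mul_nonneg_of_nonpos_of_nonpos hs this

theorem inner_truncCubeL2_nonneg (L R : ℝ) (u : L2 L) : 0 ≤ inner ℝ u (truncCubeL2 L R u) := by
  rw [inner_eq_integral]
  refine integral_nonneg_of_ae ?_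
  filter_upwards [coeFn_truncCubeL2 L R u] with x hx
  rw [hx]
  exact truncCube_mul_self_nonneg R _

/-- Integration by parts gives `-∫ g'(φ) φ'²` with `g' ≥ 0`; the boundary terms vanish by the
Neumann conditions. -/
theorem inner_truncCubeL2_toL2_nonpos {L : ℝ} (hL : 0 < L) (R : ℝ)
    {φ φ' φ'' : BoundedContinuousFunction ℝ ℝ} (h1 : ∀ x, HasDerivAt φ (φ' x) x)
    (h2 : ∀ x, HasDerivAt φ' (φ'' x) x) (h0 : φ' 0 = 0) (hφL : φ' L = 0) :
    inner ℝ (truncCubeL2 L R (toL2 L φ)) (toL2 L φ'') ≤ 0 := by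
  have e : inner ℝ (truncCubeL2 L R (toL2 L φ)) (toL2 L φ'')
      = ∫ x in (0 : ℝ)..L, truncCube R (φ x) * φ'' x := by
    rw [inner_toL2_right, intervalIntegral.integral_of_le hL.le, integral_Ioc_eq_integral_Ioo]
    refine integral_congr_ae ?_
    filter_upwards [coeFn_truncCubeL2 L R (toL2 L φ), coeFn_toL2 L φ] with x hx hx'
    rw [hx, hx']
  have hc : Continuous fun x => 3 * min (φ x ^ 2) (R ^ 2) * φ' x := by fun_prop
  rw [e, intervalIntegral.integral_mul_deriv_eq_deriv_mul (u := fun x => truncCube R (φ x))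
    (fun x _ => (hasDerivAt_truncCube R (φ x)).comp x (h1 x)) (fun x _ => h2 x)
    (hc.intervalIntegrable _ _) (φ''.continuous.intervalIntegrable _ _), h0, hφL]
  have : 0 ≤ ∫ x in (0 : ℝ)..L, 3 * min (φ x ^ 2) (R ^ 2) * φ' x * φ' x :=
    intervalIntegral.integral_nonneg hL.le fun x _ => by
      rw [mul_assoc]
      exact mul_nonneg (by positivity) (mul_self_nonneg _)
  simp only [mul_zero, sub_zero, zero_sub]
  linarith

/-- The partial cosine sums are smooth and satisfy the Neumann conditions. They and their second
derivatives converge in `L²`, and the truncated cubic acts continuously on `L²`. -/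
theorem inner_truncCubeL2_secondDeriv_nonpos {ν L : ℝ} (hν : 0 < ν) (hL : 0 < L) (R : ℝ)
    {w z : SqSum} (hz : ∀ k, z k = √(eigval ν L k) * w k) :
    inner ℝ (truncCubeL2 L R (toH1 hν hL w : L2 L)) (secondDeriv hν hL w z) ≤ 0 := by
  set a : ℕ → ℝ := fun k => (cosBasis hL).repr (toH1 hν hL w : L2 L) k with ha
  let φ : ℕ → BoundedContinuousFunction ℝ ℝ := fun N => ∑ k ∈ Finset.range N, a k • cosFun L k
  let φ' : ℕ → BoundedContinuousFunction ℝ ℝ := fun N => ∑ k ∈ Finset.range N, a k • dcosFun L k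
  let φ'' : ℕ → BoundedContinuousFunction ℝ ℝ := fun N =>
    ∑ k ∈ Finset.range N, a k • (-(freq L k ^ 2) • cosFun L k)
  have happ : ∀ (F : ℕ → BoundedContinuousFunction ℝ ℝ) (N : ℕ) (x : ℝ),
      (∑ k ∈ Finset.range N, a k • F k) x = ∑ k ∈ Finset.range N, a k * F k x := fun F N x => by
    simp [BoundedContinuousFunction.coe_sum, Finset.sum_apply]
  have hder : ∀ (F F' : ℕ → BoundedContinuousFunction ℝ ℝ),
      (∀ k x, HasDerivAt (F k) (F' k x) x) → ∀ N x,
      HasDerivAt (∑ k ∈ Finset.range N, a k • F k : BoundedContinuousFunction ℝ ℝ)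
        ((∑ k ∈ Finset.range N, a k • F' k : BoundedContinuousFunction ℝ ℝ) x) x := by
    intro F F' h N x
    rw [happ F']
    have := HasDerivAt.fun_sum (u := Finset.range N) fun k _ => (h k x).const_mul (a k)
    refine this.congr_of_eventuallyEq (Eventually.of_forall fun y => ?_)
    exact happ F N y
  have hneg : ∀ N, inner ℝ (truncCubeL2 L R (toL2 L (φ N))) (toL2 L (φ'' N)) ≤ 0 := fun N =>
    inner_truncCubeL2_toL2_nonpos hL R (hder _ _ (hasDerivAt_cosFun L) N)
      (hder _ _ (hasDerivAt_dcosFun L) N)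
      (by rw [happ]; simp [dcosFun_zero]) (by rw [happ]; simp [dcosFun_right hL])
  have l1 : Tendsto (fun N => toL2 L (φ N)) atTop (𝓝 (toH1 hν hL w : L2 L)) := by
    simpa only [φ, map_sum, map_smul] using
      (hasSum_repr_cosBasis hL (toH1 hν hL w : L2 L)).tendsto_sum_nat
  have l2 : Tendsto (fun N => toL2 L (φ'' N)) atTop (𝓝 (secondDeriv hν hL w z)) := by
    have := (hasSum_repr_cosBasis hL (secondDeriv hν hL w z)).tendsto_sum_nat
    refine this.congr fun N => ?_
    simp only [φ'', map_sum, map_smul]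
    refine Finset.sum_congr rfl fun k _ => ?_
    rw [repr_secondDeriv hν hL hz, smul_smul]
    congr 1
    ring
  exact le_of_tendsto' ((((lipschitzWith_truncCubeL2 L R).continuous.tendsto _).comp l1).inner l2)
    hneg

/-! ### The truncated feedback system -/

theorem norm_toH1_le {ν L : ℝ} (hν : 0 < ν) (hL : 0 < L) (w : SqSum) :
    ‖(toH1 hν hL w : L2 L)‖ ≤ ‖w‖ := by
  refine le_of_sq_le_sq ?_ (norm_nonneg _)
  rw [norm_sq_eq_toH1 hν hL w]
  exact le_add_of_nonneg_right (by positivity)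

theorem exists_feedback_bound {ν L c h : ℝ} (hν : 0 < ν) (hL : 0 < L) {I : H1 L →ₗ[ℝ] L2 L}
    (hI : ∀ φ : H1 L, ‖(φ : L2 L) - I φ‖ ≤ c * h * h1Norm φ) :
    ∃ C : ℝ, 0 ≤ C ∧ ∀ w, ‖I (toH1 hν hL w)‖ ≤ C * ‖w‖ := by
  -- The sign of `c` is not prescribed, hence the absolute value.
  refine ⟨1 + |c * h| * √(1 / L ^ 2 + 1 / ν), by positivity, fun w => ?_⟩
  have h1 : h1Norm (toH1 hν hL w) ≤ √(1 / L ^ 2 + 1 / ν) * ‖w‖ := by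
    refine le_of_sq_le_sq ?_ (by positivity)
    rw [mul_pow, Real.sq_sqrt (by positivity)]
    exact h1Norm_toH1_sq_le hν hL w
  have h0 : 0 ≤ h1Norm (toH1 hν hL w) := Real.sqrt_nonneg _
  calc ‖I (toH1 hν hL w)‖
      ≤ ‖(toH1 hν hL w : L2 L)‖ + ‖(toH1 hν hL w : L2 L) - I (toH1 hν hL w)‖ := by
        have := norm_sub_le (toH1 hν hL w : L2 L) ((toH1 hν hL w : L2 L) - I (toH1 hν hL w))
        rwa [sub_sub_cancel] at this
    _ ≤ ‖w‖ + |c * h| * (√(1 / L ^ 2 + 1 / ν) * ‖w‖) := by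
        refine add_le_add (norm_toH1_le hν hL w) ((hI _).trans ?_)
        calc c * h * h1Norm (toH1 hν hL w) ≤ |c * h| * h1Norm (toH1 hν hL w) := by
              gcongr; exact le_abs_self _
          _ ≤ _ := by gcongr
    _ = _ := by ring

/-- The right-hand side of the truncated system `u_t + (u - ν u_xx) = (1 + α) u - g(u) - μ I(u)`,
as a function of the coordinates of `u`. -/
def reaction {ν L : ℝ} (hν : 0 < ν) (hL : 0 < L) (α μ : ℝ) (I : H1 L →ₗ[ℝ] L2 L) (R : ℝ)
    (w : SqSum) : L2 L :=
  (1 + α) • (toH1 hν hL w : L2 L) - truncCubeL2 L R (toH1 hν hL w : L2 L)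
    - μ • I (toH1 hν hL w)

theorem exists_lipschitzWith_reaction {ν L : ℝ} (hν : 0 < ν) (hL : 0 < L) (α μ : ℝ)
    {I : H1 L →ₗ[ℝ] L2 L} {C : ℝ} (hC : ∀ w, ‖I (toH1 hν hL w)‖ ≤ C * ‖w‖) (R : ℝ) :
    ∃ K : NNReal, LipschitzWith K (reaction hν hL α μ I R) := by
  refine ⟨_, LipschitzWith.of_dist_le'
    (K := |1 + α| + (Real.toNNReal (3 * R ^ 2) : ℝ) + |μ| * C) fun v w => ?_⟩
  have h1 := (lipschitzWith_truncCubeL2 L R).norm_sub_le (toH1 hν hL v : L2 L) (toH1 hν hL w)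
  have h2 : ‖(toH1 hν hL v : L2 L) - toH1 hν hL w‖ ≤ ‖v - w‖ := by
    have := norm_toH1_le hν hL (v - w)
    rwa [map_sub] at this
  have h3 : ‖I (toH1 hν hL v) - I (toH1 hν hL w)‖ ≤ C * ‖v - w‖ := by
    have := hC (v - w)
    rwa [map_sub, map_sub] at this
  rw [dist_eq_norm, dist_eq_norm]
  have e : reaction hν hL α μ I R v - reaction hν hL α μ I R w
      = (1 + α) • ((toH1 hν hL v : L2 L) - toH1 hν hL w)
        - (truncCubeL2 L R (toH1 hν hL v : L2 L) - truncCubeL2 L R (toH1 hν hL w : L2 L))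
        - μ • (I (toH1 hν hL v) - I (toH1 hν hL w)) := by
    simp only [reaction, smul_sub]
    abel
  rw [e]
  calc _ ≤ ‖(1 + α) • ((toH1 hν hL v : L2 L) - toH1 hν hL w)‖
        + ‖truncCubeL2 L R (toH1 hν hL v : L2 L) - truncCubeL2 L R (toH1 hν hL w : L2 L)‖
        + ‖μ • (I (toH1 hν hL v) - I (toH1 hν hL w))‖ :=
        (norm_sub_le _ _).trans (by gcongr; exact norm_sub_le _ _)
    _ ≤ |1 + α| * ‖v - w‖ + Real.toNNReal (3 * R ^ 2) * ‖v - w‖ + |μ| * (C * ‖v - w‖) := by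
        rw [norm_smul, norm_smul, Real.norm_eq_abs, Real.norm_eq_abs]
        gcongr
        exact h1.trans (by gcongr)
    _ = _ := by ring

/-- Here `q` stands for `u_xx`, `g` for the truncated cubic, `J` for `I(u)`, `P` for `‖u_x‖²` and
`W` for `‖u‖² + ν ‖u_x‖²`. Testing with `-ν q` produces `-ν² ‖q‖²`, which absorbs the feedback term
up to `μ² ‖J‖²/4`. The remainder, at most `(α + μ² C²/4) W`, is beaten by the gain `K m W` from
testing with `K u`. -/
theorem inner_energy_nonpos_of_dissipation {X : Type*} [NormedAddCommGroup X]
    [InnerProductSpace ℝ X] {ν α μ K m C P W : ℝ} (hν : 0 < ν) (hα : 0 < α) (hμ : 0 < μ)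
    (hm : 0 ≤ m) (hK : 0 ≤ K) (hKm : α + μ ^ 2 * C ^ 2 / 4 ≤ K * m) {u q g J : X}
    (hqu : inner ℝ q u = -P) (hPW : ν * P ≤ W) (hW : 0 ≤ W) (hgu : 0 ≤ inner ℝ u g)
    (hgq : inner ℝ g q ≤ 0) (hJ : ‖J‖ ^ 2 ≤ C ^ 2 * W)
    (hdis : -ν * P + α * ‖u‖ ^ 2 - μ * inner ℝ u J ≤ -m * W) :
    inner ℝ (K • u + (u - ν • q)) (ν • q + α • u - g - μ • J) ≤ 0 := by
  have hqJ : ν * μ * inner ℝ q J ≤ ν ^ 2 * ‖q‖ ^ 2 + μ ^ 2 * ‖J‖ ^ 2 / 4 := by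
    have h1 := mul_le_mul_of_nonneg_left (real_inner_le_norm q J) (mul_nonneg hν.le hμ.le)
    have h2 := sq_nonneg (ν * ‖q‖ - μ * ‖J‖ / 2)
    linarith
  have e1 : inner ℝ u (ν • q + α • u - g - μ • J)
      = -ν * P + α * ‖u‖ ^ 2 - inner ℝ u g - μ * inner ℝ u J := by
    rw [inner_sub_right, inner_sub_right, inner_add_right, inner_smul_right, inner_smul_right,
      inner_smul_right, real_inner_self_eq_norm_sq, real_inner_comm q u, hqu]
    ring
  have e2 : inner ℝ q (ν • q + α • u - g - μ • J)
      = ν * ‖q‖ ^ 2 - α * P - inner ℝ g q - μ * inner ℝ q J := by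
    rw [inner_sub_right, inner_sub_right, inner_add_right, inner_smul_right, inner_smul_right,
      inner_smul_right, real_inner_self_eq_norm_sq, hqu, real_inner_comm g q]
    ring
  have a1 := mul_nonneg hν.le (neg_nonneg.2 hgq)
  have a2 := mul_le_mul_of_nonneg_left hJ (by positivity : 0 ≤ μ ^ 2 / 4)
  have a3 := mul_le_mul_of_nonneg_left hPW hα.le
  have b3 : K * (-ν * P + α * ‖u‖ ^ 2 - inner ℝ u g - μ * inner ℝ u J) ≤ K * (-m * W) :=
    mul_le_mul_of_nonneg_left (by linarith) hK
  have b4 := mul_le_mul_of_nonneg_right hKm hW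
  have b5 : 0 ≤ m * W := mul_nonneg hm hW
  rw [inner_add_left, inner_sub_left, inner_smul_left, inner_smul_left, e1, e2]
  simp only [conj_trivial]
  linarith

/-- The energy `K ‖u‖² + ‖u‖² + ν ‖u_x‖²` does not increase if `K` is large. -/
theorem inner_energy_nonpos {L ν α μ c h : ℝ} (hL : 0 < L) (hν : 0 < ν) (hα : 0 < α) (hμ : 0 < μ)
    {I : H1 L →ₗ[ℝ] L2 L} (hI : ∀ φ : H1 L, ‖(φ : L2 L) - I φ‖ ≤ c * h * h1Norm φ)
    (hr : 0 < μ - (2 * α + ν / L ^ 2)) (hνμ : μ * c ^ 2 * h ^ 2 ≤ ν) {C K : ℝ}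
    (hC : ∀ w, ‖I (toH1 hν hL w)‖ ≤ C * ‖w‖) (hK0 : 0 ≤ K)
    (hK : α + μ ^ 2 * C ^ 2 / 4 ≤ K * (min (μ - (2 * α + ν / L ^ 2)) 1 / 2)) (R : ℝ) {w z : SqSum}
    (hz : ∀ k, z k = √(eigval ν L k) * w k) :
    inner ℝ (K • (toH1 hν hL w : L2 L) + (cosBasis hL).repr.symm z)
      (reaction hν hL α μ I R w - (cosBasis hL).repr.symm z) ≤ 0 := by
  have hZ : (cosBasis hL).repr.symm z
      = (toH1 hν hL w : L2 L) - ν • secondDeriv hν hL w z := by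
    rw [secondDeriv, smul_smul, mul_one_div_cancel hν.ne', one_smul, sub_sub_cancel]
  have hut : reaction hν hL α μ I R w - (cosBasis hL).repr.symm z
      = ν • secondDeriv hν hL w z + α • (toH1 hν hL w : L2 L)
        - truncCubeL2 L R (toH1 hν hL w : L2 L) - μ • I (toH1 hν hL w) := by
    rw [hZ, reaction, add_smul, one_smul]
    abel
  have hw := norm_sq_eq_toH1 hν hL w
  rw [hut, hZ]
  refine inner_energy_nonpos_of_dissipation (C := C) (P := ‖weakDeriv (toH1 hν hL w)‖ ^ 2)
    (W := ‖w‖ ^ 2) hν hα hμ (div_nonneg (lt_min hr one_pos).le zero_le_two) hK0 hK ?_ ?_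
    (sq_nonneg _) (inner_truncCubeL2_nonneg L R _)
    (inner_truncCubeL2_secondDeriv_nonpos hν hL R hz) ?_ ?_
  · rw [(isWeakDeriv_secondDeriv hν hL hz).inner_eq_of_neumann hL
      (vanishesAtEndpoints_weakDeriv hν hL hz), real_inner_self_eq_norm_sq]
  · rw [hw]
    exact le_add_of_nonneg_left (sq_nonneg _)
  · rw [← mul_pow]
    exact pow_le_pow_left₀ (norm_nonneg _) (hC w) 2
  -- The rates `r/2` on `‖u‖²` and `1/2` on `ν ‖u_x‖²` are both at least `min r 1 / 2`.
  · refine (dissipation (α := α) hμ hI hνμ (toH1 hν hL w)).trans ?_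
    rw [hw]
    have hm1 := min_le_left (μ - (2 * α + ν / L ^ 2)) 1
    have hm2 := min_le_right (μ - (2 * α + ν / L ^ 2)) 1
    generalize min (μ - (2 * α + ν / L ^ 2)) 1 = m at hm1 hm2
    generalize μ - (2 * α + ν / L ^ 2) = r at hm1
    have a1 := mul_le_mul_of_nonneg_right hm1 (sq_nonneg ‖(toH1 hν hL w : L2 L)‖)
    have a2 := mul_le_mul_of_nonneg_right hm2
      (mul_nonneg hν.le (sq_nonneg ‖weakDeriv (toH1 hν hL w)‖))
    linarith

theorem ae_restrict_Ioi_of_forall_Ioo {P : ℝ → Prop}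
    (h : ∀ T, 0 < T → ∀ᵐ t ∂volume.restrict (Ioo 0 T), P t) :
    ∀ᵐ t ∂volume.restrict (Ioi (0 : ℝ)), P t := by
  have h1 : ∀ n : ℕ, ∀ᵐ t ∂(volume : Measure ℝ), t ∈ Ioo (0 : ℝ) (n + 1) → P t := fun n =>
    (ae_restrict_iff' measurableSet_Ioo).1 (h (n + 1) (by positivity))
  rw [ae_restrict_iff' measurableSet_Ioi]
  filter_upwards [ae_all_iff.2 h1] with t ht hpos
  obtain ⟨n, hn⟩ := exists_nat_gt t
  exact ht n ⟨hpos, by linarith⟩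

theorem memLp_Ioo_of_continuous {X : Type*} [NormedAddCommGroup X] {f : ℝ → X}
    (hf : Continuous f) (T : ℝ) : MemLp f 2 (volume.restrict (Ioo 0 T)) := by
  obtain ⟨C, hC⟩ := isCompact_Icc.exists_bound_of_continuousOn (hf.continuousOn (s := Icc 0 T))
  refine MemLp.of_bound
    ((hf.continuousOn (s := Ioo 0 T)).aestronglyMeasurable measurableSet_Ioo) C ?_
  filter_upwards [ae_restrict_mem measurableSet_Ioo] with t ht
  exact hC t (Ioo_subset_Icc_self ht)

/-! ### Integration of the energy inequality -/

theorem SqSum.inner_trunc (N : ℕ) (x y : SqSum) :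
    inner ℝ (SqSum.trunc N x) y = ∑ k ∈ Finset.range N, x k * y k := by
  rw [SqSum.trunc_eq_sum, sum_inner]
  refine Finset.sum_congr rfl fun k _ => ?_
  rw [lp.inner_single_left]
  simp [mul_comm]

/-- `a` holds the coefficients of `u`; then `z = √λ w` represents `u - ν u_xx` and `f - z`
represents `u_t`. The energy identity is exact for finitely many modes, where everything is
differentiable, and passes to the limit because `z` is in `L²(0, T; ℓ²)`. The sign hypothesis
concerns the full inner product and is used only after that limit. -/
theorem norm_sq_le_of_inner_energy_nonpos {lam : ℕ → ℝ} (hlam : ∀ k, 0 < lam k) {w₀ : SqSum}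
    {f w a : ℝ → SqSum} (hf : Continuous f) (hw : ∀ t, 0 ≤ t → w t = duhamel lam w₀ f t)
    (hwc : Continuous w) (hac : Continuous a) (ha : ∀ t k, a t k = w t k / √(lam k)) {K : ℝ}
    (hK : 0 ≤ K)
    (hle : ∀ᵐ t ∂volume.restrict (Ioi (0 : ℝ)),
      inner ℝ (K • a t + toSqSum fun k => √(lam k) * w t k)
        (f t - toSqSum fun k => √(lam k) * w t k) ≤ 0) {T : ℝ} (hT : 0 ≤ T) :
    ‖w T‖ ^ 2 ≤ K * ‖a 0‖ ^ 2 + ‖w 0‖ ^ 2 := by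
  have hlam' : ∀ k, 0 ≤ lam k := fun k => (hlam k).le
  set z : ℝ → SqSum := fun t => toSqSum fun k => √(lam k) * w t k with hzdef
  have hzmem : MemLp z 2 (volume.restrict (Ioo 0 T)) := memLp_of_mild hlam' hf hw hwc hT
  have hzae := ae_memℓp_of_mild hlam' hf hw hwc hT
  let S : ℕ → ℝ → ℝ := fun N t => ∑ k ∈ Finset.range N, (K * a t k ^ 2 + w t k ^ 2)
  let D : ℕ → ℝ → ℝ := fun N t => ∑ k ∈ Finset.range N,
    2 * ((K * a t k + √(lam k) * w t k) * (f t k - √(lam k) * w t k))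
  have hDc : ∀ N, Continuous (D N) := fun N => continuous_finsetSum _ fun k _ => by
    have := continuous_coord hf k
    have := continuous_coord hwc k
    have := continuous_coord hac k
    fun_prop
  have hSc : ∀ N, Continuous (S N) := fun N => continuous_finsetSum _ fun k _ => by
    have := continuous_coord hwc k
    have := continuous_coord hac k
    fun_prop
  have hSD : ∀ N t, 0 < t → HasDerivAt (S N) (D N t) t := fun N t ht => by
    refine HasDerivAt.fun_sum fun k _ => ?_
    have h1 := hasDerivAt_coord_of_mild hlam' hf hw k ht
    have h2 : HasDerivAt (fun t => a t k)
        ((-lam k * w t k + √(lam k) * f t k) / √(lam k)) t := by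
      simp_rw [ha]
      exact h1.div_const _
    refine (((h2.pow 2).const_mul K).add (h1.pow 2)).congr_deriv ?_
    have h3 := Real.sqrt_pos.2 (hlam k)
    have h4 := Real.mul_self_sqrt (hlam k).le
    have h5 : (-lam k * w t k + √(lam k) * f t k) / √(lam k) = f t k - √(lam k) * w t k := by
      rw [div_eq_iff h3.ne']
      linear_combination w t k * h4
    have h6 : -lam k * w t k + √(lam k) * f t k = √(lam k) * (f t k - √(lam k) * w t k) := by
      linear_combination w t k * h4
    rw [h5, h6]
    push_cast
    ring
  have hFTC : ∀ N, ∫ t in (0 : ℝ)..T, D N t = S N T - S N 0 := fun N =>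
    intervalIntegral.integral_eq_sub_of_hasDerivAt_of_le hT (hSc N).continuousOn
      (fun t ht => hSD N t ht.1) ((hDc N).intervalIntegrable _ _)
  have hDz : ∀ᵐ t ∂volume.restrict (Ioo 0 T), ∀ N,
      D N t = 2 * inner ℝ (SqSum.trunc N (K • a t + z t)) (f t - z t) := by
    filter_upwards [hzae] with t ht N
    rw [SqSum.inner_trunc, Finset.mul_sum]
    refine Finset.sum_congr rfl fun k _ => ?_
    have hzk : z t k = √(lam k) * w t k := toSqSum_apply ht k
    rw [lp.coeFn_add, lp.coeFn_sub, lp.coeFn_smul, Pi.add_apply, Pi.sub_apply, Pi.smul_apply, hzk,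
      smul_eq_mul]
  -- Truncation does not increase norms, so a product of two functions in `L²(0, T)` dominates all
  -- the truncated inner products.
  have hlim : Tendsto (fun N => ∫ t in Ioo 0 T, D N t) atTop
      (𝓝 (∫ t in Ioo 0 T, 2 * inner ℝ (K • a t + z t) (f t - z t))) := by
    have m1 : MemLp (fun t => K • a t + z t) 2 (volume.restrict (Ioo 0 T)) :=
      (memLp_Ioo_of_continuous (hac.const_smul K) T).add hzmem
    have m2 : MemLp (fun t => f t - z t) 2 (volume.restrict (Ioo 0 T)) :=
      (memLp_Ioo_of_continuous hf T).sub hzmem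
    refine tendsto_integral_of_dominated_convergence
      (fun t => 2 * (‖K • a t + z t‖ * ‖f t - z t‖))
      (fun N => (hDc N).aestronglyMeasurable) ((m1.norm.integrable_mul m2.norm).const_mul 2)
      (fun N => ?_) ?_
    · filter_upwards [hDz] with t ht
      rw [ht N, norm_mul, Real.norm_of_nonneg zero_le_two]
      refine mul_le_mul_of_nonneg_left ((norm_inner_le_norm _ _).trans ?_) zero_le_two
      exact mul_le_mul_of_nonneg_right (SqSum.norm_trunc_le N _) (norm_nonneg _)
    · filter_upwards [hDz] with t ht
      simp_rw [ht]
      exact ((SqSum.tendsto_trunc _).inner tendsto_const_nhds).const_mul 2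
  have hS : ∀ t, Tendsto (fun N => S N t) atTop (𝓝 (K * ‖a t‖ ^ 2 + ‖w t‖ ^ 2)) := fun t =>
    (((a t).hasSum_sq.mul_left K).add (w t).hasSum_sq).tendsto_sum_nat
  have heq : ∀ N, ∫ t in Ioo 0 T, D N t = S N T - S N 0 := fun N => by
    rw [← hFTC, intervalIntegral.integral_of_le hT, integral_Ioc_eq_integral_Ioo]
  simp_rw [heq] at hlim
  have hfinal := tendsto_nhds_unique hlim ((hS T).sub (hS 0))
  have hneg : ∫ t in Ioo 0 T, 2 * inner ℝ (K • a t + z t) (f t - z t) ≤ 0 := by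
    refine integral_nonpos_of_ae ?_
    filter_upwards [ae_restrict_of_ae_restrict_of_subset Ioo_subset_Ioi_self hle] with t ht
    simp only [Pi.zero_apply]
    linarith
  rw [hfinal] at hneg
  have : 0 ≤ K * ‖a T‖ ^ 2 := by positivity
  linarith

/-! ### Passage from coordinates back to functions -/

theorem continuous_toH1 {ν L : ℝ} (hν : 0 < ν) (hL : 0 < L) :
    Continuous fun w => (toH1 hν hL w : L2 L) :=
  LipschitzWith.continuous (K := 1) <| LipschitzWith.of_dist_le_mul fun v w => by
    have := norm_toH1_le hν hL (v - w)
    rw [map_sub] at this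
    simpa [dist_eq_norm] using this

theorem tendsto_h1Norm_toH1 {ν L : ℝ} (hν : 0 < ν) (hL : 0 < L) {w : ℝ → SqSum}
    (hw : Continuous w) (t : ℝ) :
    Tendsto (fun s => h1Norm (toH1 hν hL (w s) - toH1 hν hL (w t))) (𝓝 t) (𝓝 0) := by
  have h1 : Tendsto (fun s => √(1 / L ^ 2 + 1 / ν) * ‖w s - w t‖) (𝓝 t) (𝓝 0) := by
    have : Continuous fun s => √(1 / L ^ 2 + 1 / ν) * ‖w s - w t‖ := by fun_prop
    simpa using this.tendsto t
  refine squeeze_zero (fun s => Real.sqrt_nonneg _) (fun s => ?_) h1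
  rw [← map_sub]
  refine le_of_sq_le_sq ?_ (by positivity)
  rw [mul_pow, Real.sq_sqrt (by positivity)]
  exact h1Norm_toH1_sq_le hν hL _

/-- The coordinates of a mild solution satisfy the evolution equation in integrated form. -/
theorem toH1_eq_add_integral {ν L : ℝ} (hν : 0 < ν) (hL : 0 < L) {w₀ : SqSum}
    {w : ℝ → SqSum} {F : ℝ → L2 L} (hF : Continuous F) (hwc : Continuous w)
    (hw : ∀ t, 0 ≤ t → w t = duhamel (eigval ν L) w₀ (fun s => (cosBasis hL).repr (F s)) t)
    {ut : ℝ → L2 L}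
    (hut : ∀ t, ut t = F t -
      (cosBasis hL).repr.symm (toSqSum fun k => √(eigval ν L k) * w t k))
    {t : ℝ} (ht : 0 ≤ t) (hint : IntervalIntegrable ut volume 0 t) :
    (toH1 hν hL (w t) : L2 L) = (toH1 hν hL (w 0) : L2 L) + ∫ s in (0 : ℝ)..t, ut s := by
  have hlam : ∀ k, 0 ≤ eigval ν L k := fun k => (eigval_pos hν L k).le
  have hfc : Continuous fun s => (cosBasis hL).repr (F s) :=
    (cosBasis hL).repr.continuous.comp hF
  refine (cosBasis hL).repr.injective ?_
  ext k
  rw [map_add, lp.coeFn_add, Pi.add_apply, repr_toH1, repr_toH1]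
  let ℓ : L2 L →L[ℝ] ℝ := innerSL ℝ (toL2 L (cosFun L k))
  have hℓ : ∀ v, (cosBasis hL).repr v k = ℓ v := fun v => by
    rw [repr_cosBasis, innerSL_apply_apply, real_inner_comm]
  rw [hℓ, ← ContinuousLinearMap.intervalIntegral_comp_comm ℓ hint]
  -- Outside a null set of times `√λ_k w_k` is square-summable, so `toSqSum` does not take its
  -- default value.
  have hae : ∀ᵐ s ∂volume.restrict (Ioo 0 t),
      ℓ (ut s) = (cosBasis hL).repr (F s) k - √(eigval ν L k) * w s k := by
    filter_upwards [ae_memℓp_of_mild hlam hfc hw hwc ht] with s hs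
    rw [← hℓ, hut, map_sub, LinearIsometryEquiv.apply_symm_apply, lp.coeFn_sub, Pi.sub_apply,
      toSqSum_apply hs]
  have h3 := Real.sqrt_pos.2 (eigval_pos hν L k)
  have h4 := Real.mul_self_sqrt (hlam k)
  have hd : ∀ s ∈ Ioo 0 t, HasDerivAt (fun s => w s k / √(eigval ν L k))
      ((cosBasis hL).repr (F s) k - √(eigval ν L k) * w s k) s := fun s hs => by
    refine ((hasDerivAt_coord_of_mild hlam hfc hw k hs.1).div_const _).congr_deriv ?_
    rw [div_eq_iff h3.ne']
    linear_combination w s k * h4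
  have hwk := continuous_coord hwc k
  have hfk := continuous_coord hfc k
  have hFTC := intervalIntegral.integral_eq_sub_of_hasDerivAt_of_le ht
    (by fun_prop) hd (Continuous.intervalIntegrable (by fun_prop) _ _)
  rw [intervalIntegral.integral_of_le ht, integral_Ioc_eq_integral_Ioo, integral_congr_ae hae,
    ← integral_Ioc_eq_integral_Ioo, ← intervalIntegral.integral_of_le ht, hFTC]
  ring

/-! ### Existence of a global solution -/

theorem exists_isGlobalSolution {L ν α μ c h : ℝ} (hL : 0 < L) (hν : 0 < ν) (hα : 0 < α)
    (hμ : 0 < μ) {I : H1 L →ₗ[ℝ] L2 L}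
    (hI : ∀ φ : H1 L, ‖(φ : L2 L) - I φ‖ ≤ c * h * h1Norm φ)
    (hr : 0 < μ - (2 * α + ν / L ^ 2)) (hνμ : μ * c ^ 2 * h ^ 2 ≤ ν) (u₀ : H1 L) :
    ∃ u : ℝ → H1 L, IsGlobalSolution L ν α μ I u₀ u := by
  obtain ⟨w₀, hw₀⟩ := exists_toH1_eq hν hL u₀
  obtain ⟨C, hC0, hC⟩ := exists_feedback_bound hν hL hI
  have hm : 0 < min (μ - (2 * α + ν / L ^ 2)) 1 / 2 := half_pos (lt_min hr one_pos)
  set m := min (μ - (2 * α + ν / L ^ 2)) 1 / 2 with hmdef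
  -- The smallest weight allowed by the energy estimate; it involves only the coefficients and the
  -- bound `C` on the feedback, not `R`.
  set K := (α + μ ^ 2 * C ^ 2 / 4) / m with hKdef
  have hK0 : 0 ≤ K := by positivity
  have hK : α + μ ^ 2 * C ^ 2 / 4 ≤ K * m := by rw [hKdef, div_mul_cancel₀ _ hm.ne']
  -- The a priori bound is `‖w t‖ ≤ √(K + 1) ‖w₀‖` whatever the truncation level, so the resulting
  -- sup norm bound can serve as that level without circularity.
  set R := embeddingConst ν L * (√(K + 1) * ‖w₀‖) with hR
  obtain ⟨Λ, hΛ⟩ := exists_lipschitzWith_reaction hν hL α μ hC R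
  obtain ⟨w, hwc, hw⟩ := exists_mild_solution (lam := eigval ν L)
    (fun k => (eigval_pos hν L k).le) w₀ ((cosBasis hL).repr.lipschitz.comp hΛ)
  have hlam : ∀ k, 0 ≤ eigval ν L k := fun k => (eigval_pos hν L k).le
  have hFc : Continuous fun t => reaction hν hL α μ I R (w t) := hΛ.continuous.comp hwc
  have hfc : Continuous fun t => (cosBasis hL).repr (reaction hν hL α μ I R (w t)) :=
    (cosBasis hL).repr.continuous.comp hFc
  have hw0 : w 0 = w₀ := by rw [hw 0 le_rfl]; exact duhamel_zero hlam w₀ hfc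
  set z : ℝ → SqSum := fun t => toSqSum fun k => √(eigval ν L k) * w t k with hzdef
  have hz : ∀ᵐ t ∂volume.restrict (Ioi (0 : ℝ)), ∀ k, z t k = √(eigval ν L k) * w t k := by
    refine ae_restrict_Ioi_of_forall_Ioo fun T hT => ?_
    filter_upwards [ae_memℓp_of_mild hlam hfc hw hwc hT.le] with t ht k
    exact toSqSum_apply ht k
  have hzmem : ∀ T, 0 < T → MemLp (fun t => (cosBasis hL).repr.symm (z t)) 2
      (volume.restrict (Ioo 0 T)) := fun T hT =>
    (cosBasis hL).repr.symm.toContinuousLinearEquiv.toContinuousLinearMap.comp_memLp'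
      (memLp_of_mild hlam hfc hw hwc hT.le)
  have huc : Continuous fun t => (toH1 hν hL (w t) : L2 L) := (continuous_toH1 hν hL).comp hwc
  have hbound : ∀ t, 0 ≤ t → ‖w t‖ ≤ √(K + 1) * ‖w₀‖ := by
    intro t ht
    have h1 := norm_sq_le_of_inner_energy_nonpos (eigval_pos hν L) hfc hw hwc
      (a := fun t => (cosBasis hL).repr (toH1 hν hL (w t) : L2 L))
      ((cosBasis hL).repr.continuous.comp huc) (fun t k => repr_toH1 hν hL (w t) k) hK0 (by
        filter_upwards [hz] with s hs
        have h2 := inner_energy_nonpos hL hν hα hμ hI hr hνμ hC hK0 hK R hs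
        rw [← LinearIsometryEquiv.inner_map_map (cosBasis hL).repr, map_add, map_sub, map_smul,
          LinearIsometryEquiv.apply_symm_apply] at h2
        exact h2) ht
    refine le_of_sq_le_sq (h1.trans ?_) (by positivity)
    rw [mul_pow, Real.sq_sqrt (by positivity), LinearIsometryEquiv.norm_map, hw0]
    have h3 := pow_le_pow_left₀ (norm_nonneg _) (norm_toH1_le hν hL w₀) 2
    have h4 := mul_le_mul_of_nonneg_left h3 hK0
    linarith
  set ut : ℝ → L2 L := fun t => reaction hν hL α μ I R (w t) - (cosBasis hL).repr.symm (z t)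
    with hutdef
  have hutmem : ∀ T, 0 < T → MemLp ut 2 (volume.restrict (Ioo 0 T)) := fun T hT =>
    (memLp_Ioo_of_continuous hFc T).sub (hzmem T hT)
  refine ⟨fun t => toH1 hν hL (w t), by simp only [hw0, hw₀],
    fun t _ => (tendsto_h1Norm_toH1 hν hL hwc t).mono_left nhdsWithin_le_nhds,
    ut, fun t => secondDeriv hν hL (w t) (z t), hutmem, fun T hT => ?_, fun t ht => ?_, ?_⟩
  · exact ((memLp_Ioo_of_continuous huc T).sub (hzmem T hT)).const_smul (1 / ν)
  · refine toH1_eq_add_integral hν hL hFc hwc hw (fun _ => rfl) ht ?_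
    exact (intervalIntegrable_of_memLp_two (by linarith) (hutmem (t + 1) (by linarith))).mono_set
      (uIcc_subset_uIcc_left (by rw [uIcc_of_le (by linarith)]; exact ⟨ht, by linarith⟩))
  · filter_upwards [hz, ae_restrict_mem measurableSet_Ioi] with t hzt htpos
    refine ⟨isWeakDeriv_secondDeriv hν hL hzt, vanishesAtEndpoints_weakDeriv hν hL hzt, ?_⟩
    have hut : ut t = ν • secondDeriv hν hL (w t) (z t) + α • (toH1 hν hL (w t) : L2 L)
        - truncCubeL2 L R (toH1 hν hL (w t) : L2 L) - μ • I (toH1 hν hL (w t)) := by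
      rw [hutdef, secondDeriv, smul_smul, mul_one_div_cancel hν.ne', one_smul]
      simp only [reaction]
      rw [add_smul, one_smul]
      abel
    have hsup := ae_abs_toH1_le hν hL (w t)
    have hemb : 0 ≤ embeddingConst ν L := by unfold embeddingConst; positivity
    rw [hut]
    generalize secondDeriv hν hL (w t) (z t) = q
    generalize hI' : I (toH1 hν hL (w t)) = J
    generalize hu' : (toH1 hν hL (w t) : L2 L) = v at hsup ⊢
    filter_upwards [hsup, coeFn_truncCubeL2 L R v,
      Lp.coeFn_sub (ν • q + α • v - truncCubeL2 L R v) (μ • J),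
      Lp.coeFn_sub (ν • q + α • v) (truncCubeL2 L R v), Lp.coeFn_add (ν • q) (α • v),
      Lp.coeFn_smul ν q, Lp.coeFn_smul α v, Lp.coeFn_smul μ J]
      with x h1 h2 c1 c2 c3 c4 c5 c6
    -- The solution stays in the range where the truncated cubic is `s ^ 3`, so it solves the
    -- original equation.
    have h3 : |v x| ≤ R := h1.trans (mul_le_mul_of_nonneg_left (hbound t (le_of_lt htpos)) hemb)
    simp only [Pi.sub_apply, Pi.add_apply, Pi.smul_apply, smul_eq_mul] at c1 c2 c3 c4 c5 c6
    rw [c1, c2, c3, c4, c5, c6, h2, truncCube_eq h3]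
    ring

/-- This is the comparison solution that turns the estimate for differences into `L²` decay. -/
theorem isGlobalSolution_zero (L ν α μ : ℝ) (I : H1 L →ₗ[ℝ] L2 L) :
    IsGlobalSolution L ν α μ I 0 fun _ => 0 := by
  have hd : weakDeriv (0 : H1 L) = 0 := weakDeriv_eq (IsWeakDeriv.zero L)
  have h0 := Lp.coeFn_zero ℝ 2 (volume.restrict (Ioo (0 : ℝ) L))
  refine ⟨rfl, fun t _ => by simpa [h1Norm, hd] using tendsto_const_nhds,
    fun _ => 0, fun _ => 0, fun T _ => MemLp.zero,
    fun T _ => MemLp.zero, fun t _ => by simp, ae_of_all _ fun t => ?_⟩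
  rw [hd]
  refine ⟨IsWeakDeriv.zero L, ⟨fun _ => 0, continuousOn_const, h0, rfl, rfl⟩, ?_⟩
  rw [map_zero]
  filter_upwards [h0] with x hx
  have hx' : (0 : L2 L) x = 0 := hx
  change (0 : L2 L) x - ν * (0 : L2 L) x - α * (0 : L2 L) x + (0 : L2 L) x ^ 3 = -μ * (0 : L2 L) x
  rw [hx']
  ring

end ChafeeInfante

end

/-! ### Existence, uniqueness and decay -/

theorem mainTheorem1 (L ν α μ c h : ℝ) (hL : 0 < L) (hν : 0 < ν) (hα : 0 < α) (hμ : 0 < μ)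
    (hh : 0 < h)
    (I : ChafeeInfante.H1 L →ₗ[ℝ] ChafeeInfante.L2 L)
    (hI : ∀ φ : ChafeeInfante.H1 L,
      ‖(φ : ChafeeInfante.L2 L) - I φ‖ ≤ c * h * ChafeeInfante.h1Norm φ)
    (hr : 0 < μ - (2 * α + ν / L ^ 2))
    (hνμ : μ * c ^ 2 * h ^ 2 ≤ ν)
    (u₀ : ChafeeInfante.H1 L) :
    ∃ u : ℝ → ChafeeInfante.H1 L,
      ChafeeInfante.IsGlobalSolution L ν α μ I u₀ u ∧
      (∀ v : ℝ → ChafeeInfante.H1 L,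
        ChafeeInfante.IsGlobalSolution L ν α μ I u₀ v → ∀ t : ℝ, 0 ≤ t → v t = u t) ∧
      ∀ t : ℝ, 0 ≤ t →
        ‖(u t : ChafeeInfante.L2 L)‖ ^ 2 ≤
          Real.exp (-(μ - (2 * α + ν / L ^ 2)) * t) * ‖(u₀ : ChafeeInfante.L2 L)‖ ^ 2 := by
  obtain ⟨u, hu⟩ := ChafeeInfante.exists_isGlobalSolution hL hν hα hμ hI hr hνμ u₀
  refine ⟨u, hu, fun v hv t ht => ?_, fun t ht => ?_⟩
  -- Both solutions start at `u₀`, so the right side of the difference estimate is zero.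
  · have h1 := hv.norm_sub_sq_le hL hν hμ hI hνμ hu ht
    rw [sub_self, norm_zero, zero_pow two_ne_zero, mul_zero] at h1
    have h2 := pow_eq_zero_iff two_ne_zero |>.1 (le_antisymm h1 (sq_nonneg _))
    exact Subtype.ext (sub_eq_zero.1 (norm_eq_zero.1 h2))
  · have h1 := hu.norm_sub_sq_le hL hν hμ hI hνμ (ChafeeInfante.isGlobalSolution_zero L ν α μ I) ht
    simpa using h1
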